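/- Let $M^{2n+1}$ be a connected smooth manifold with an almost $\alpha$-cosymplectic structure $(\phi,\xi,\eta,g)$, $\alpha\in\mathbb R$. That is, $\phi$ is a smooth $(1,1)$-tensor field, $\xi$ a smooth vector field, $\eta$ a smooth 1-form and $g$ a Riemannian metric with $$\phi^2=-I+\eta\otimes\xi,\qquad \eta(\xi)=1,\qquad g(\phi X,\phi Y)=g(X,Y)-\eta(X)\eta(Y),$$ and, with $\Phi(X,Y)=g(\phi X,Y)$, $$d\eta=0,\qquad d\Phi=2\alpha\,\eta\wedge\Phi .$$ Let $\nabla$ be the Levi-Civita connection of $g$, $R(X,Y)=[\nabla_X,\nabla_Y]-\nabla_{[X,Y]}$, $h=\frac12\mathcal L_\xi\phi$, $A=\alpha\phi^2+\phi h$ and $\mathcal D=\ker\eta$. Assume that 1. $\nabla_\xi h=0$; 2. there is a point $p\in M$ at which every tangent plane containing $\xi_p$ has sectional curvature different from $-\alpha^2$, where the sectional curvature of the plane spanned by $X,\xi$ is $K(\xi,X)=g(R(X,\xi)\xi,X)/\bigl(g(X,X)g(\xi,\xi)-g(X,\xi)^2\bigr)$; 3. $h$ is $\eta$-parallel, i.e.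 $g((\nabla_Xh)Y,Z)=0$ for all vector fields $X,Y,Z$ orthogonal to $\xi$. Then $$(\nabla_X\phi)Y=-g(\phi AX,Y)\,\xi+\eta(Y)\,\phi AX$$ for all vector fields $X,Y$ on $M$. Moreover, the integral submanifolds of $\mathcal D$ are Kaehlerian: for every smooth immersion $\iota:N^{2n}\to M$ with $d\iota(T_qN)=\mathcal D_{\iota(q)}$ for all $q\in N$, the pair $(J,\iota^*g)$ with $d\iota\circ J=\phi\circ d\iota$ is a Kaehler structure on $N$, i.e. $J$ is an integrable almost complex structure (its Nijenhuis tensor vanishes), $\iota^*g$ is $J$-Hermitian, and its fundamental 2-form is closed. -/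

import Mathlib

open scoped Manifold ContDiff
open Bundle

noncomputable section

namespace AlmostContact

section Riemannian

variable {E : Type*} [NormedAddCommGroup E] [NormedSpace ℝ E]
  {M : Type*} [TopologicalSpace M] [ChartedSpace E M]

variable (E M) in
/-- Vector fields (without regularity) on a manifold `M` modelled on `E`. -/
abbrev Field : Type _ := Π x : M, TangentSpace 𝓘(ℝ, E) x

variable (E M) in
/-- Fields of endomorphisms of the tangent spaces, i.e. `(1,1)`-tensor fields. -/
abbrev EndField : Type _ := Π x : M, TangentSpace 𝓘(ℝ, E) x →L[ℝ] TangentSpace 𝓘(ℝ, E) x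

variable (E M) in
/-- Fields of linear forms on the tangent spaces, i.e. 1-forms. -/
abbrev FormField : Type _ := Π x : M, TangentSpace 𝓘(ℝ, E) x →L[ℝ] ℝ

/-- Smooth vector fields. -/
def IsSmooth [IsManifold 𝓘(ℝ, E) ∞ M] (X : Field E M) : Prop :=
  ContMDiff 𝓘(ℝ, E) (𝓘(ℝ, E).prod 𝓘(ℝ, E)) ∞ (fun x ↦ TotalSpace.mk' E x (X x))

/-- Smooth `(1,1)`-tensor fields. -/
def IsSmoothEnd [IsManifold 𝓘(ℝ, E) ∞ M] (φ : EndField E M) : Prop :=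
  ContMDiff 𝓘(ℝ, E) (𝓘(ℝ, E).prod 𝓘(ℝ, E →L[ℝ] E)) ∞
    (fun x ↦ TotalSpace.mk' (E →L[ℝ] E)
      (E := fun x : M ↦ TangentSpace 𝓘(ℝ, E) x →L[ℝ] TangentSpace 𝓘(ℝ, E) x) x (φ x))

/-- Smooth 1-forms. -/
def IsSmoothForm [IsManifold 𝓘(ℝ, E) ∞ M] (η : FormField E M) : Prop :=
  ContMDiff 𝓘(ℝ, E) (𝓘(ℝ, E).prod 𝓘(ℝ, E →L[ℝ] ℝ)) ∞
    (fun x ↦ TotalSpace.mk' (E →L[ℝ] ℝ)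
      (E := fun x : M ↦ TangentSpace 𝓘(ℝ, E) x →L[ℝ] ℝ) x (η x))

variable (E M) in
/-- Smooth Riemannian metrics on `M`. -/
abbrev Metric [IsManifold 𝓘(ℝ, E) ∞ M] : Type _ :=
  ContMDiffRiemannianMetric 𝓘(ℝ, E) ∞ E (fun x : M ↦ TangentSpace 𝓘(ℝ, E) x)

/-- The Lie bracket `[X, Y]`. -/
abbrev bracket (X Y : Field E M) : Field E M := VectorField.mlieBracket 𝓘(ℝ, E) X Y

/-- The derivative `X f` of a function `f` along a vector field `X`. -/
def dirDeriv (X : Field E M) (f : M → ℝ) (x : M) : ℝ := mvfderiv 𝓘(ℝ, E) f x (X x)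

/-- The action of a `(1,1)`-tensor field on vector fields. -/
def EndField.act (φ : EndField E M) (X : Field E M) : Field E M := fun x ↦ φ x (X x)

/-- The exterior derivative of a 1-form, `dη(X, Y) = X η(Y) - Y η(X) - η([X, Y])`. -/
def extDerivOne (η : FormField E M) (X Y : Field E M) (x : M) : ℝ :=
  dirDeriv X (fun y ↦ η y (Y y)) x - dirDeriv Y (fun y ↦ η y (X y)) x - η x (bracket X Y x)

/-- The exterior derivative of a 2-form `Ω`, given by its values on vector fields:
`dΩ(X, Y, Z) = X Ω(Y, Z) + Y Ω(Z, X) + Z Ω(X, Y) - Ω([X, Y], Z) - Ω([Y, Z], X) - Ω([Z, X], Y)`. -/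
def extDerivTwo (Ω : Field E M → Field E M → M → ℝ) (X Y Z : Field E M) (x : M) : ℝ :=
  dirDeriv X (Ω Y Z) x + dirDeriv Y (Ω Z X) x + dirDeriv Z (Ω X Y) x
    - Ω (bracket X Y) Z x - Ω (bracket Y Z) X x - Ω (bracket Z X) Y x

/-- The wedge product of a 1-form and a 2-form,
`(η ∧ Ω)(X, Y, Z) = η(X) Ω(Y, Z) + η(Y) Ω(Z, X) + η(Z) Ω(X, Y)`. -/
def wedgeOneTwo (η : FormField E M) (Ω : Field E M → Field E M → M → ℝ)
    (X Y Z : Field E M) (x : M) : ℝ :=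
  η x (X x) * Ω Y Z x + η x (Y x) * Ω Z X x + η x (Z x) * Ω X Y x

variable [IsManifold 𝓘(ℝ, E) ∞ M]

/-- The 2-form `(X, Y) ↦ g(φ X, Y)`. -/
def fundForm (φ : EndField E M) (g : Metric E M) (X Y : Field E M) (x : M) : ℝ :=
  g.inner x (φ x (X x)) (Y x)

/-- The right hand side of the Koszul formula for `2 g(∇_X Y, Z)`. -/
def koszul (g : Metric E M) (X Y Z : Field E M) (x : M) : ℝ :=
  dirDeriv X (fun y ↦ g.inner y (Y y) (Z y)) x
    + dirDeriv Y (fun y ↦ g.inner y (X y) (Z y)) x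
    - dirDeriv Z (fun y ↦ g.inner y (X y) (Y y)) x
    + g.inner x (bracket X Y x) (Z x)
    - g.inner x (bracket X Z x) (Y x)
    - g.inner x (bracket Y Z x) (X x)

/-- The Levi-Civita connection `∇_X Y` of `g`: its value at `x` is the vector `v` such that
`2 g(v, Z) = koszul g X Y Z` at `x` for all vector fields `Z` differentiable at `x`. For `X`, `Y`
differentiable at `x` there is exactly one such `v`, see `leviCivita_spec` and
`eq_leviCivita`. -/
def leviCivita (g : Metric E M) (X Y : Field E M) : Field E M := fun x ↦
  Classical.epsilon fun v : TangentSpace 𝓘(ℝ, E) x ↦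
    ∀ Z : Field E M, MDifferentiableAt 𝓘(ℝ, E) (𝓘(ℝ, E).prod 𝓘(ℝ, E))
        (fun y ↦ TotalSpace.mk' E y (Z y)) x →
      2 * g.inner x v (Z x) = koszul g X Y Z x

theorem mdifferentiableAt_inner (g : Metric E M) {Y Z : Field E M} {x : M}
    (hY : MDifferentiableAt 𝓘(ℝ, E) (𝓘(ℝ, E).prod 𝓘(ℝ, E)) (fun y ↦ TotalSpace.mk' E y (Y y)) x)
    (hZ : MDifferentiableAt 𝓘(ℝ, E) (𝓘(ℝ, E).prod 𝓘(ℝ, E)) (fun y ↦ TotalSpace.mk' E y (Z y)) x) :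
    MDifferentiableAt 𝓘(ℝ, E) 𝓘(ℝ, ℝ) (fun y ↦ g.inner y (Y y) (Z y)) x := by
  have hg := (g.contMDiff x).mdifferentiableAt (by simp)
  have := MDifferentiableAt.clm_bundle_apply₂ (F₃ := ℝ) (E₃ := Bundle.Trivial M ℝ) hg hY hZ
  rw [mdifferentiableAt_totalSpace] at this
  exact this.2

/-- The Koszul expression is tensorial in the last variable. -/
theorem tensorialAt_koszul [CompleteSpace E] (g : Metric E M) {X Y : Field E M} {x : M}
    (hX : MDifferentiableAt 𝓘(ℝ, E) (𝓘(ℝ, E).prod 𝓘(ℝ, E)) (fun y ↦ TotalSpace.mk' E y (X y)) x)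
    (hY : MDifferentiableAt 𝓘(ℝ, E) (𝓘(ℝ, E).prod 𝓘(ℝ, E)) (fun y ↦ TotalSpace.mk' E y (Y y)) x) :
    TensorialAt 𝓘(ℝ, E) E (fun Z : Field E M ↦ koszul g X Y Z x) x where
  smul {f Z} hf hZ := by
    have e1 : (fun y ↦ g.inner y (Y y) ((f • Z) y)) =
        fun y ↦ f y * g.inner y (Y y) (Z y) := by ext y; simp
    have e2 : (fun y ↦ g.inner y (X y) ((f • Z) y)) =
        fun y ↦ f y * g.inner y (X y) (Z y) := by ext y; simp
    have b1 := VectorField.mlieBracket_smul_right (V := X) hf hZ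
    have b2 := VectorField.mlieBracket_smul_right (V := Y) hf hZ
    simp only [koszul, dirDeriv, bracket, e1, e2, b1, b2,
      mvfderiv_fun_mul hf (mdifferentiableAt_inner g hY hZ),
      mvfderiv_fun_mul hf (mdifferentiableAt_inner g hX hZ)]
    simp [g.symm x (Z x)]
    ring
  add {Z W} hZ hW := by
    have e1 : (fun y ↦ g.inner y (Y y) ((Z + W) y)) =
        fun y ↦ g.inner y (Y y) (Z y) + g.inner y (Y y) (W y) := by ext y; simp
    have e2 : (fun y ↦ g.inner y (X y) ((Z + W) y)) =
        fun y ↦ g.inner y (X y) (Z y) + g.inner y (X y) (W y) := by ext y; simp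
    have b1 := VectorField.mlieBracket_add_right (V := X) hZ hW
    have b2 := VectorField.mlieBracket_add_right (V := Y) hZ hW
    simp only [koszul, dirDeriv, bracket, e1, e2, b1, b2,
      mvfderiv_fun_add (mdifferentiableAt_inner g hY hZ) (mdifferentiableAt_inner g hY hW),
      mvfderiv_fun_add (mdifferentiableAt_inner g hX hZ) (mdifferentiableAt_inner g hX hW)]
    simp
    ring

/-- Every linear form on a tangent space is represented by a tangent vector. -/
theorem exists_inner_eq [FiniteDimensional ℝ E] (g : Metric E M) (x : M)
    (f : TangentSpace 𝓘(ℝ, E) x →L[ℝ] ℝ) :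
    ∃ v, ∀ w, g.inner x v w = f w := by
  have : FiniteDimensional ℝ (TangentSpace 𝓘(ℝ, E) x) := inferInstanceAs (FiniteDimensional ℝ E)
  let B : TangentSpace 𝓘(ℝ, E) x →ₗ[ℝ] Module.Dual ℝ (TangentSpace 𝓘(ℝ, E) x) :=
    LinearMap.mk₂ ℝ (fun v w ↦ g.inner x v w) (by simp) (by simp) (by simp) (by simp)
  have hB : Function.Injective B := by
    rw [← LinearMap.ker_eq_bot, LinearMap.ker_eq_bot']
    intro v hv
    by_contra h
    exact (g.pos x v h).ne' (LinearMap.congr_fun hv v)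
  have hs : Function.Surjective B :=
    (LinearMap.injective_iff_surjective_of_finrank_eq_finrank
      (Subspace.dual_finrank_eq (K := ℝ)).symm).1 hB
  obtain ⟨v, hv⟩ := hs f.toLinearMap
  exact ⟨v, fun w ↦ LinearMap.congr_fun hv w⟩

/-- The defining property of the Levi-Civita connection. -/
theorem leviCivita_spec [FiniteDimensional ℝ E] (g : Metric E M) {X Y Z : Field E M} {x : M}
    (hX : MDifferentiableAt 𝓘(ℝ, E) (𝓘(ℝ, E).prod 𝓘(ℝ, E)) (fun y ↦ TotalSpace.mk' E y (X y)) x)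
    (hY : MDifferentiableAt 𝓘(ℝ, E) (𝓘(ℝ, E).prod 𝓘(ℝ, E)) (fun y ↦ TotalSpace.mk' E y (Y y)) x)
    (hZ : MDifferentiableAt 𝓘(ℝ, E) (𝓘(ℝ, E).prod 𝓘(ℝ, E)) (fun y ↦ TotalSpace.mk' E y (Z y)) x) :
    2 * g.inner x (leviCivita g X Y x) (Z x) = koszul g X Y Z x := by
  have : CompleteSpace E := FiniteDimensional.complete ℝ E
  have ht := tensorialAt_koszul g hX hY
  obtain ⟨v, hv⟩ := exists_inner_eq g x ((1 / 2 : ℝ) • TensorialAt.mkHom _ x ht)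
  refine Classical.epsilon_spec (p := fun v : TangentSpace 𝓘(ℝ, E) x ↦
    ∀ Z : Field E M, MDifferentiableAt 𝓘(ℝ, E) (𝓘(ℝ, E).prod 𝓘(ℝ, E))
        (fun y ↦ TotalSpace.mk' E y (Z y)) x →
      2 * g.inner x v (Z x) = koszul g X Y Z x) ⟨v, fun W hW ↦ ?_⟩ Z hZ
  have := TensorialAt.mkHom_apply ht hW
  rw [hv, ← this]
  simp

/-- Uniqueness of the Levi-Civita connection. -/
theorem eq_leviCivita [FiniteDimensional ℝ E] (g : Metric E M) {X Y : Field E M} {x : M}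
    (hX : MDifferentiableAt 𝓘(ℝ, E) (𝓘(ℝ, E).prod 𝓘(ℝ, E)) (fun y ↦ TotalSpace.mk' E y (X y)) x)
    (hY : MDifferentiableAt 𝓘(ℝ, E) (𝓘(ℝ, E).prod 𝓘(ℝ, E)) (fun y ↦ TotalSpace.mk' E y (Y y)) x)
    (v : TangentSpace 𝓘(ℝ, E) x)
    (hv : ∀ Z : Field E M, MDifferentiableAt 𝓘(ℝ, E) (𝓘(ℝ, E).prod 𝓘(ℝ, E))
        (fun y ↦ TotalSpace.mk' E y (Z y)) x →
      2 * g.inner x v (Z x) = koszul g X Y Z x) : v = leviCivita g X Y x := by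
  by_contra h
  have h' : v - leviCivita g X Y x ≠ 0 := sub_ne_zero.2 h
  have hd := FiberBundle.mdifferentiableAt_extend 𝓘(ℝ, E) E (v - leviCivita g X Y x)
  have h1 := hv _ hd
  have h2 := leviCivita_spec g hX hY hd
  rw [FiberBundle.extend_apply_self] at h1 h2
  have h3 := (g.pos x _ h').ne'
  apply h3
  rw [map_sub (g.inner x), sub_apply]
  linarith

/-- The covariant derivative `(∇_X T) Y = ∇_X (T Y) - T (∇_X Y)` of a `(1,1)`-tensor, given by its
action on vector fields. -/
def covDerivEnd (g : Metric E M) (T : Field E M → Field E M) (X Y : Field E M) : Field E M :=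
  leviCivita g X (T Y) - T (leviCivita g X Y)

/-- The curvature `R(X, Y) Z = ∇_X ∇_Y Z - ∇_Y ∇_X Z - ∇_[X,Y] Z`. -/
def curvature (g : Metric E M) (X Y Z : Field E M) : Field E M :=
  leviCivita g X (leviCivita g Y Z) - leviCivita g Y (leviCivita g X Z)
    - leviCivita g (bracket X Y) Z

/-- The sectional curvature at `x` of the plane spanned by `X x` and `Y x`,
`g(R(X, Y) Y, X) / (g(X, X) g(Y, Y) - g(X, Y)²)`. -/
def sectionalCurvature (g : Metric E M) (X Y : Field E M) (x : M) : ℝ :=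
  g.inner x (curvature g X Y Y x) (X x) /
    (g.inner x (X x) (X x) * g.inner x (Y x) (Y x) - g.inner x (X x) (Y x) ^ 2)

/-- The Lie derivative of a `(1,1)`-tensor field, `(L_V φ) X = [V, φ X] - φ [V, X]`. -/
def lieDerivEnd (V : Field E M) (φ : EndField E M) (X : Field E M) : Field E M :=
  bracket V (φ.act X) - φ.act (bracket V X)

/-- `(J, g)` is a Kaehler structure on `M`: `J` is a smooth almost complex structure with vanishing
Nijenhuis tensor `J²[X, Y] + [JX, JY] - J[JX, Y] - J[X, JY]`, the Riemannian metric `g` is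
Hermitian, and the fundamental form `g(JX, Y)` is closed. -/
structure IsKaehler (J : EndField E M) (g : Metric E M) : Prop where
  smooth : IsSmoothEnd J
  sq : ∀ (x : M) (v : TangentSpace 𝓘(ℝ, E) x), J x (J x v) = -v
  hermitian : ∀ (x : M) (v w : TangentSpace 𝓘(ℝ, E) x),
    g.inner x (J x v) (J x w) = g.inner x v w
  integrable : ∀ X Y : Field E M, IsSmooth X → IsSmooth Y →
    J.act (J.act (bracket X Y)) + bracket (J.act X) (J.act Y)
      - J.act (bracket (J.act X) Y) - J.act (bracket X (J.act Y)) = 0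
  closed : ∀ X Y Z : Field E M, IsSmooth X → IsSmooth Y → IsSmooth Z →
    extDerivTwo (fundForm J g) X Y Z = 0

variable (E M) in
/-- An almost contact metric structure `(φ, ξ, η, g)`. -/
structure AlmostContactMetric where
  φ : EndField E M
  ξ : Field E M
  η : FormField E M
  g : Metric E M
  smooth_φ : IsSmoothEnd φ
  smooth_ξ : IsSmooth ξ
  smooth_η : IsSmoothForm η
  φ_sq : ∀ (x : M) (v : TangentSpace 𝓘(ℝ, E) x), φ x (φ x v) = -v + η x v • ξ x
  η_ξ : ∀ x : M, η x (ξ x) = 1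
  compatible : ∀ (x : M) (v w : TangentSpace 𝓘(ℝ, E) x),
    g.inner x (φ x v) (φ x w) = g.inner x v w - η x v * η x w

namespace AlmostContactMetric

/-- Almost `α`-cosymplectic structures: `dη = 0` and `dΦ = 2 α η ∧ Φ`, where
`Φ(X, Y) = g(φ X, Y)`. -/
structure IsAlmostCosymplectic (S : AlmostContactMetric E M) (α : ℝ) : Prop where
  d_η : ∀ X Y : Field E M, IsSmooth X → IsSmooth Y → extDerivOne S.η X Y = 0
  d_fundForm : ∀ X Y Z : Field E M, IsSmooth X → IsSmooth Y → IsSmooth Z → ∀ x,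
    extDerivTwo (fundForm S.φ S.g) X Y Z x = 2 * α * wedgeOneTwo S.η (fundForm S.φ S.g) X Y Z x

/-- The tensor field `h = (1/2) L_ξ φ`. -/
def h (S : AlmostContactMetric E M) (X : Field E M) : Field E M :=
  (1 / 2 : ℝ) • lieDerivEnd S.ξ S.φ X

/-- The tensor field `A = α φ² + φ h`. -/
def A (S : AlmostContactMetric E M) (α : ℝ) (X : Field E M) : Field E M :=
  α • S.φ.act (S.φ.act X) + S.φ.act (S.h X)

/-- A `(1,1)`-tensor `B`, given by its action on vector fields, is `η`-parallel if
`g((∇_X B) Y, Z) = 0` for all vector fields `X`, `Y`, `Z` orthogonal to `ξ`. -/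
def IsEtaParallel (S : AlmostContactMetric E M) (B : Field E M → Field E M) : Prop :=
  ∀ X Y Z : Field E M, IsSmooth X → IsSmooth Y → IsSmooth Z →
    (∀ x, S.η x (X x) = 0) → (∀ x, S.η x (Y x) = 0) → (∀ x, S.η x (Z x) = 0) →
    ∀ x, S.g.inner x (covDerivEnd S.g B X Y x) (Z x) = 0

/-- At `p`, all sectional curvatures of planes containing `ξ` are different from `c`. -/
def XiSectionalCurvatureNeAt (S : AlmostContactMetric E M) (c : ℝ) (p : M) : Prop :=
  ∀ X : Field E M, IsSmooth X → LinearIndependent ℝ ![X p, S.ξ p] →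
    sectionalCurvature S.g X S.ξ p ≠ c

/-- `ι : N → M` is an (immersed) integral submanifold of the distribution `D = ker η`: a smooth
immersion whose tangent spaces are the spaces `D`. -/
structure IsIntegralSubmanifold (S : AlmostContactMetric E M)
    {F : Type*} [NormedAddCommGroup F] [NormedSpace ℝ F]
    {N : Type*} [TopologicalSpace N] [ChartedSpace F N] (ι : N → M) : Prop where
  smooth : ContMDiff 𝓘(ℝ, F) 𝓘(ℝ, E) ∞ ι
  injective : ∀ q : N, Function.Injective (mfderiv 𝓘(ℝ, F) 𝓘(ℝ, E) ι q)
  range_eq : ∀ q : N, Set.range (mfderiv 𝓘(ℝ, F) 𝓘(ℝ, E) ι q) = {v | S.η (ι q) v = 0}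

/-- The structure induced by `(φ, g)` on `N` along `ι : N → M` is a Kaehler structure: there are
`J` and a Riemannian metric `gN` on `N` with `dι (J v) = φ (dι v)`, `gN = ι^* g`, and `(J, gN)` is
Kaehler. -/
def InducesKaehlerOn (S : AlmostContactMetric E M)
    {F : Type*} [NormedAddCommGroup F] [NormedSpace ℝ F]
    {N : Type*} [TopologicalSpace N] [ChartedSpace F N] [IsManifold 𝓘(ℝ, F) ∞ N]
    (ι : N → M) : Prop :=
  ∃ (J : EndField F N) (gN : Metric F N),
    (∀ (q : N) (v : TangentSpace 𝓘(ℝ, F) q),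
      mfderiv 𝓘(ℝ, F) 𝓘(ℝ, E) ι q (J q v) = S.φ (ι q) (mfderiv 𝓘(ℝ, F) 𝓘(ℝ, E) ι q v)) ∧
    (∀ (q : N) (v w : TangentSpace 𝓘(ℝ, F) q),
      gN.inner q v w =
        S.g.inner (ι q) (mfderiv 𝓘(ℝ, F) 𝓘(ℝ, E) ι q v) (mfderiv 𝓘(ℝ, F) 𝓘(ℝ, E) ι q w)) ∧
    IsKaehler J gN

end AlmostContactMetric

end Riemannian

end AlmostContact

end

/-!
Write `B = ∇ξ`. Since `η` is closed, `B` is symmetric and `B ξ = 0`. The cyclic sum of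
`g((∇_X φ) Y, Z)` is `dΦ`, hence `2 α η ∧ Φ`; with one argument equal to `ξ` this expresses `∇_ξ φ`
through `B` and `φ`, and comparison with the derivative of `φ² = -1 + η ⊗ ξ` gives `∇_ξ φ = 0` and
`φ B + B φ = 2 α φ` (`φ_nablaXi`). Consequently `h = φ B - α φ` is symmetric, anticommutes with `φ`,
and `A = -B`.

The first assertion says that `φ` is `η`-parallel: a tensor `T` with `T ξ = 0`, `η ∘ T = 0` and
`∇_ξ T = 0` has `∇ T` determined by `B` and its horizontal part
(`covDerivEnd_eq_of_isEtaParallel`). On `ker η`, `∇φ` satisfies the identities of an almost Kaehler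
manifold, in particular `(∇_{φX} φ) φ Z = -(∇_X φ) Z` in the weak sense of `nablaPhi_φ_left`. As `h`
is `η`-parallel, differentiating `φ h + h φ = 0` shows that `∇_X φ` anticommutes with `h`, whereas the
almost Kaehler identity, used for the directions `X` and `φ X`, shows that it commutes with `h`. So
`∇_X φ` vanishes on the image of `h`, and all that is needed is that `h` is invertible on `ker η` at
every point (`isEtaParallel_φ`).

Invertibility holds at the point where the sectional curvatures are not `-α²`: from `∇_ξ h = 0` one
gets `R(X, ξ) ξ = -B² X`, and a horizontal `v` with `h v = 0` satisfies `B v = α v`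
(`eq_zero_of_hEnd_eq_zero`). It propagates to all of `M` because the determinant of
`T = h + η ⊗ ξ` is constant: the covariant derivative of `T` is of the form
`g(u, ·) ξ + η ⊗ u` with `u` horizontal, so that `tr ((∇_X T) T⁻¹) = 0` wherever `T` is invertible
(`dirDeriv_det_eq_zero`, `hEnd_injective`). Hence `det T` has vanishing derivative wherever it does
not vanish, and `M` is connected (`eq_of_mvfderiv_eq_zero`).

For the second assertion, vector fields on an integral submanifold are extended locally to `M`
(`exists_relatedAt`), and brackets of related fields are related (`RelatedAt.bracket_apply`). The
Nijenhuis tensor of `J` and the exterior derivative of its fundamental form are therefore the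
restrictions of those of `φ`. The former vanishes on `ker η` by the formula for `∇φ`, the latter
because `dΦ = 2 α η ∧ Φ`.
-/

namespace AlmostContact

section Toolbox

variable {E : Type*} [NormedAddCommGroup E] [NormedSpace ℝ E]
  {M : Type*} [TopologicalSpace M] [ChartedSpace E M] [IsManifold 𝓘(ℝ, E) ∞ M]

open Filter Topology Matrix

/-! ### Smooth vector fields -/

namespace IsSmooth

variable {X Y : Field E M}

theorem mdifferentiableAt (hX : IsSmooth X) (x : M) :
    MDifferentiableAt 𝓘(ℝ, E) (𝓘(ℝ, E).prod 𝓘(ℝ, E)) (fun y ↦ TotalSpace.mk' E y (X y)) x :=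
  (hX x).mdifferentiableAt (by simp)

theorem add (hX : IsSmooth X) (hY : IsSmooth Y) : IsSmooth (X + Y) :=
  ContMDiff.add_section hX hY

theorem sub (hX : IsSmooth X) (hY : IsSmooth Y) : IsSmooth (X - Y) :=
  ContMDiff.sub_section hX hY

theorem neg (hX : IsSmooth X) : IsSmooth (-X) :=
  ContMDiff.neg_section hX

theorem const_smul (c : ℝ) (hX : IsSmooth X) : IsSmooth (c • X) :=
  ContMDiff.const_smul_section hX

theorem smul {f : M → ℝ} (hf : ContMDiff 𝓘(ℝ, E) 𝓘(ℝ, ℝ) ∞ f) (hX : IsSmooth X) :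
    IsSmooth (f • X) :=
  ContMDiff.smul_section hf hX

variable (E M) in
theorem zero : IsSmooth (0 : Field E M) :=
  contMDiff_zeroSection ℝ _

theorem act {φ : EndField E M} (hφ : IsSmoothEnd φ) (hX : IsSmooth X) : IsSmooth (φ.act X) :=
  ContMDiff.clm_bundle_apply (F₁ := E) (F₂ := E) hφ hX

theorem bracket [CompleteSpace E] (hX : IsSmooth X) (hY : IsSmooth Y) :
    IsSmooth (bracket X Y) := by
  have : IsManifold 𝓘(ℝ, E) (((⊤ : ℕ∞) : WithTop ℕ∞) + 1) M :=
    inferInstanceAs (IsManifold 𝓘(ℝ, E) ∞ M)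
  have : IsManifold 𝓘(ℝ, E) (minSmoothness ℝ 2) M := by
    rw [minSmoothness_of_isRCLikeNormedField]; infer_instance
  exact ContDiff.mlieBracket_vectorField (m := (⊤ : ℕ∞)) (n := (⊤ : ℕ∞)) hX hY (by simp)

theorem form_apply {η : FormField E M} (hη : IsSmoothForm η) (hX : IsSmooth X) :
    ContMDiff 𝓘(ℝ, E) 𝓘(ℝ, ℝ) ∞ (fun x ↦ η x (X x)) := by
  have := ContMDiff.clm_bundle_apply (F₁ := E) (F₂ := ℝ) (E₂ := Bundle.Trivial M ℝ) hη hX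
  intro x
  have := this x
  rw [contMDiffAt_totalSpace] at this
  exact this.2

theorem inner (g : Metric E M) (hX : IsSmooth X) (hY : IsSmooth Y) :
    ContMDiff 𝓘(ℝ, E) 𝓘(ℝ, ℝ) ∞ (fun x ↦ g.inner x (X x) (Y x)) := by
  have := ContMDiff.clm_bundle_apply₂ (F₁ := E) (F₂ := E) (F₃ := ℝ) (E₃ := Bundle.Trivial M ℝ)
    g.contMDiff hX hY
  intro x
  have := this x
  rw [contMDiffAt_totalSpace] at this
  exact this.2

end IsSmooth

theorem contMDiff_dirDeriv {f : M → ℝ} (hf : ContMDiff 𝓘(ℝ, E) 𝓘(ℝ, ℝ) ∞ f) {X : Field E M}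
    (hX : IsSmooth X) : ContMDiff 𝓘(ℝ, E) 𝓘(ℝ, ℝ) ∞ (dirDeriv X f) := by
  have h1 : ContMDiff 𝓘(ℝ, E).tangent 𝓘(ℝ, ℝ).tangent ∞ (tangentMap 𝓘(ℝ, E) 𝓘(ℝ, ℝ) f) :=
    hf.contMDiff_tangentMap (by simp)
  exact (contMDiff_snd_tangentBundle_modelSpace ℝ 𝓘(ℝ, ℝ)).comp (h1.comp hX)

/-- A vector field that is smooth near a point agrees near that point with a globally smooth
one. -/
theorem exists_isSmooth_eventuallyEq [FiniteDimensional ℝ E] [T2Space M] {X : Field E M} {x : M}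
    (hX : ∀ᶠ y in 𝓝 x, ContMDiffAt 𝓘(ℝ, E) (𝓘(ℝ, E).prod 𝓘(ℝ, E)) ∞
      (fun y ↦ TotalSpace.mk' E y (X y)) y) :
    ∃ Y : Field E M, IsSmooth Y ∧ Y =ᶠ[𝓝 x] X := by
  obtain ⟨u, hu, huo, hxu⟩ := eventually_nhds_iff.1 hX
  obtain ⟨f, -, hf⟩ := (SmoothBumpFunction.nhds_basis_tsupport (I := 𝓘(ℝ, E)) x).mem_iff.1
    (huo.mem_nhds hxu)
  refine ⟨(f : M → ℝ) • X, ?_, ?_⟩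
  · exact ContMDiffOn.smul_section_of_tsupport (u := u) f.contMDiff.contMDiffOn huo hf
      fun y hy ↦ (hu y hy).contMDiffWithinAt
  · filter_upwards [f.eventuallyEq_one] with y hy
    change f y • X y = X y
    rw [hy]
    exact one_smul ℝ _

/-- There are smooth vector fields which form a basis of each tangent space near a given point. -/
theorem exists_frame [FiniteDimensional ℝ E] [T2Space M] (x : M) {ι : Type*} [Finite ι]
    (b : Module.Basis ι ℝ E) :
    ∃ e : ι → Field E M, (∀ i, IsSmooth (e i)) ∧
      ∀ᶠ y in 𝓝 x, ∃ b' : Module.Basis ι ℝ (TangentSpace 𝓘(ℝ, E) y), ∀ i, b' i = e i y := by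
  set t := trivializationAt E (TangentSpace 𝓘(ℝ, E)) x with ht
  have hxt : x ∈ t.baseSet := FiberBundle.mem_baseSet_trivializationAt' x
  have h : ∀ i, ∃ Y : Field E M, IsSmooth Y ∧ Y =ᶠ[𝓝 x] t.localFrame b i := fun i ↦ by
    refine exists_isSmooth_eventuallyEq ?_
    filter_upwards [t.open_baseSet.mem_nhds hxt] with y hy
    exact contMDiffAt_localFrame_of_mem ∞ t b i hy
  choose e he1 he2 using h
  refine ⟨e, he1, ?_⟩
  filter_upwards [eventually_all.2 he2, t.open_baseSet.mem_nhds hxt] with y hy hyt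
  exact ⟨t.basisAt b hyt, fun i ↦ by rw [hy i, t.localFrame_apply_of_mem_baseSet b hyt]⟩

/-- Every tangent vector is the value of a globally smooth vector field. -/
theorem exists_isSmooth_apply_eq [FiniteDimensional ℝ E] [T2Space M] (x : M)
    (v : TangentSpace 𝓘(ℝ, E) x) : ∃ X : Field E M, IsSmooth X ∧ X x = v := by
  obtain ⟨s, hs, h⟩ := FiberBundle.exists_contMDiffOn_extend (k := ∞) 𝓘(ℝ, E) E v
  obtain ⟨Y, hY, hYX⟩ := exists_isSmooth_eventuallyEq (X := FiberBundle.extend E v) (x := x) <| by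
    filter_upwards [eventually_mem_nhds_iff.2 hs] with y hy
    exact h.contMDiffAt hy
  exact ⟨Y, hY, by rw [hYX.eq_of_nhds, FiberBundle.extend_apply_self]⟩

omit [IsManifold 𝓘(ℝ, E) ∞ M] in
/-- Smoothness of a map into continuous linear maps out of a finite dimensional space can be
checked pointwise. -/
theorem contMDiffAt_clm_of_apply [FiniteDimensional ℝ E] {F : Type*} [NormedAddCommGroup F]
    [NormedSpace ℝ F] {V : Type*} [NormedAddCommGroup V] [NormedSpace ℝ V] [FiniteDimensional ℝ V]
    {f : M → V →L[ℝ] F} {x : M}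
    (h : ∀ v, ContMDiffAt 𝓘(ℝ, E) 𝓘(ℝ, F) ∞ (fun y ↦ f y v) x) :
    ContMDiffAt 𝓘(ℝ, E) 𝓘(ℝ, V →L[ℝ] F) ∞ f x := by
  let d := Module.finrank ℝ V
  have hd : d = Module.finrank ℝ (Fin d → ℝ) := (Module.finrank_fin_fun ℝ).symm
  let e₁ := ContinuousLinearEquiv.ofFinrankEq hd
  let e₂ := (e₁.arrowCongr (1 : F ≃L[ℝ] F)).trans (ContinuousLinearEquiv.piRing (Fin d))
  have key : ContMDiffAt 𝓘(ℝ, E) 𝓘(ℝ, Fin d → F) ∞ (fun y ↦ e₂ (f y)) x := by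
    rw [contMDiffAt_pi_space]
    intro i
    exact h (e₁.symm (Pi.single i 1))
  refine (e₂.symm.contDiff.contMDiff.contMDiffAt.comp x key).congr_of_eventuallyEq
    (.of_forall fun y ↦ ?_)
  exact (e₂.symm_apply_apply (f y)).symm

/-- A field of endomorphisms is smooth if it maps smooth vector fields to smooth vector fields. -/
theorem isSmoothEnd_of_act [FiniteDimensional ℝ E] [T2Space M] {T : EndField E M}
    (h : ∀ X, IsSmooth X → IsSmooth (T.act X)) : IsSmoothEnd T := by
  intro x
  rw [contMDiffAt_hom_bundle]
  refine ⟨contMDiffAt_id, contMDiffAt_clm_of_apply fun v ↦ ?_⟩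
  set t := trivializationAt E (TangentSpace 𝓘(ℝ, E)) x with ht
  have hxt : x ∈ t.baseSet := FiberBundle.mem_baseSet_trivializationAt' x
  obtain ⟨X, hX, hXv⟩ := exists_isSmooth_eventuallyEq (x := x)
    (X := fun y ↦ t.symm y v) <| by
      filter_upwards [t.open_baseSet.mem_nhds hxt] with y hy
      rw [t.contMDiffAt_section_iff hy]
      refine contMDiffAt_const.congr_of_eventuallyEq (f := fun _ ↦ v) ?_
      filter_upwards [t.open_baseSet.mem_nhds hy] with z hz
      simp [hz]
  have := (t.contMDiffAt_section_iff hxt).1 (h X hX x)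
  refine this.congr_of_eventuallyEq ?_
  filter_upwards [hXv, t.open_baseSet.mem_nhds hxt] with y hy hyt
  rw [ContinuousLinearMap.inCoordinates_eq hyt hyt]
  simp [EndField.act, hy, ← ht]

/-- A vector is determined by its scalar products with smooth vector fields. -/
theorem eq_of_inner_eq [FiniteDimensional ℝ E] [T2Space M] (g : Metric E M) {x : M}
    {v w : TangentSpace 𝓘(ℝ, E) x}
    (h : ∀ Z : Field E M, IsSmooth Z → g.inner x v (Z x) = g.inner x w (Z x)) : v = w := by
  by_contra hvw
  have h' : v - w ≠ 0 := sub_ne_zero.2 hvw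
  obtain ⟨Z, hZ, hZx⟩ := exists_isSmooth_apply_eq x (v - w)
  apply (g.pos x _ h').ne'
  have := h Z hZ
  rw [hZx] at this
  rw [map_sub (g.inner x), _root_.sub_apply, this, sub_self]

omit [IsManifold 𝓘(ℝ, E) ∞ M] in
theorem contMDiffAt_det {ι : Type*} [Fintype ι] [DecidableEq ι] {A : M → Matrix ι ι ℝ} {x : M}
    (h : ∀ i j, ContMDiffAt 𝓘(ℝ, E) 𝓘(ℝ, ℝ) ∞ (fun y ↦ A y i j) x) :
    ContMDiffAt 𝓘(ℝ, E) 𝓘(ℝ, ℝ) ∞ (fun y ↦ (A y).det) x := by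
  simp only [Matrix.det_apply']
  exact ContMDiffAt.sum fun σ _ ↦ contMDiffAt_const.mul (contMDiffAt_finsetProd fun i _ ↦ h _ _)

/-- The Gram matrix of a basis is invertible. -/
theorem det_gram_ne_zero (g : Metric E M) {x : M} {ι : Type*} [Fintype ι] [DecidableEq ι]
    (b : Module.Basis ι ℝ (TangentSpace 𝓘(ℝ, E) x)) :
    (Matrix.of fun i j ↦ g.inner x (b i) (b j)).det ≠ 0 := by
  intro h
  obtain ⟨c, hc, hc'⟩ := Matrix.exists_mulVec_eq_zero_iff.2 h
  have hv : ∑ i, c i • b i ≠ 0 := fun h0 ↦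
    hc (funext (Fintype.linearIndependent_iff.1 b.linearIndependent c h0))
  have hw : ∀ i, g.inner x (b i) (∑ j, c j • b j) = 0 := fun i ↦ by
    have := congrFun hc' i
    simpa [Matrix.mulVec, dotProduct, mul_comm] using this
  refine (g.pos x _ hv).ne' ?_
  rw [g.symm, map_sum]
  refine Finset.sum_eq_zero fun i _ ↦ ?_
  rw [map_smul, g.symm, hw, smul_zero]

/-- Smoothness of a vector field can be checked on its scalar products with smooth vector fields:
by Cramer's rule, its coefficients in a frame are smooth. -/
theorem isSmooth_of_inner [FiniteDimensional ℝ E] [T2Space M] (g : Metric E M) {X : Field E M}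
    (h : ∀ Z : Field E M, IsSmooth Z →
      ContMDiff 𝓘(ℝ, E) 𝓘(ℝ, ℝ) ∞ (fun x ↦ g.inner x (X x) (Z x))) : IsSmooth X := by
  intro x
  obtain ⟨e, he, heb⟩ := exists_frame (M := M) x (Module.finBasis ℝ E)
  let G : M → Matrix (Fin (Module.finrank ℝ E)) (Fin (Module.finrank ℝ E)) ℝ :=
    fun y ↦ .of fun i j ↦ g.inner y (e i y) (e j y)
  let v : M → Fin (Module.finrank ℝ E) → ℝ := fun y j ↦ g.inner y (X y) (e j y)
  have hG : ∀ i j, ContMDiffAt 𝓘(ℝ, E) 𝓘(ℝ, ℝ) ∞ (fun y ↦ G y i j) x := fun i j ↦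
    (IsSmooth.inner g (he i) (he j)) x
  have hv : ∀ j, ContMDiffAt 𝓘(ℝ, E) 𝓘(ℝ, ℝ) ∞ (fun y ↦ v y j) x := fun j ↦ h _ (he j) x
  have hG0 : ∀ᶠ y in 𝓝 x, (G y).det ≠ 0 := by
    filter_upwards [heb] with y ⟨b, hb⟩
    simpa only [hb] using det_gram_ne_zero g b
  have hc : ∀ i, ContMDiffAt 𝓘(ℝ, E) 𝓘(ℝ, ℝ) ∞
      (fun y ↦ ((G y).updateCol i (v y)).det / (G y).det) x := fun i ↦ by
    refine ContMDiffAt.div₀ (contMDiffAt_det fun k l ↦ ?_) (contMDiffAt_det hG) hG0.self_of_nhds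
    by_cases hl : l = i
    · subst hl
      simpa using hv k
    · simpa [Matrix.updateCol_ne hl] using hG k l
  have key : ContMDiffAt 𝓘(ℝ, E) (𝓘(ℝ, E).prod 𝓘(ℝ, E)) ∞ (fun y ↦ TotalSpace.mk' E y
      (∑ i, (((G y).updateCol i (v y)).det / (G y).det) • e i y)) x :=
    ContMDiffAt.sum_section fun i _ ↦ ContMDiffAt.smul_section (hc i) (he i x)
  refine key.congr_of_eventuallyEq ?_
  filter_upwards [heb, hG0] with y ⟨b, hb⟩ hy
  have hGv : G y *ᵥ b.repr (X y) = v y := by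
    ext j
    have h1 : v y j = g.inner y (∑ i, b.repr (X y) i • b i) (e j y) := by rw [b.sum_repr]
    rw [h1, g.symm, map_sum]
    change ∑ i, G y j i * b.repr (X y) i = _
    refine Finset.sum_congr rfl fun i _ ↦ ?_
    rw [map_smul, hb, mul_comm]
    rfl
  have hcr : ∀ i, ((G y).updateCol i (v y)).det / (G y).det = b.repr (X y) i := fun i ↦ by
    have h1 := congrFun (Matrix.cramer_eq_adjugate_mulVec (G y) (v y)) i
    rw [Matrix.cramer_apply, ← hGv, Matrix.mulVec_mulVec, Matrix.adjugate_mul, Matrix.smul_mulVec,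
      Matrix.one_mulVec, hGv] at h1
    rw [h1, Pi.smul_apply, smul_eq_mul, mul_div_cancel_left₀ _ hy]
  have hX : X y = ∑ i, (((G y).updateCol i (v y)).det / (G y).det) • e i y := by
    conv_lhs => rw [← b.sum_repr (X y)]
    exact Finset.sum_congr rfl fun i _ ↦ by rw [hcr, hb]
  exact congrArg (TotalSpace.mk' E y) hX

end Toolbox

section LeviCivita

variable {E : Type*} [NormedAddCommGroup E] [NormedSpace ℝ E]
  {M : Type*} [TopologicalSpace M] [ChartedSpace E M] [IsManifold 𝓘(ℝ, E) ∞ M]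

open Filter Topology

/-! ### The Levi-Civita connection -/

/-- Differentiability of a vector field at a point. -/
abbrev DiffAt (X : Field E M) (x : M) : Prop :=
  MDifferentiableAt 𝓘(ℝ, E) (𝓘(ℝ, E).prod 𝓘(ℝ, E)) (fun y ↦ TotalSpace.mk' E y (X y)) x

theorem DiffAt.add {X Y : Field E M} {x : M} (hX : DiffAt X x) (hY : DiffAt Y x) :
    DiffAt (X + Y) x := mdifferentiableAt_add_section hX hY

theorem DiffAt.smul {f : M → ℝ} {Y : Field E M} {x : M}
    (hf : MDifferentiableAt 𝓘(ℝ, E) 𝓘(ℝ, ℝ) f x) (hY : DiffAt Y x) :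
    DiffAt (f • Y) x := MDifferentiableAt.smul_section hf hY

section Pointwise

variable [CompleteSpace E] (g : Metric E M) {X X' Y Y' Z : Field E M} {x : M} {f : M → ℝ}

theorem koszul_add_left (hX : DiffAt X x) (hX' : DiffAt X' x) (hY : DiffAt Y x) (hZ : DiffAt Z x) :
    koszul g (X + X') Y Z x = koszul g X Y Z x + koszul g X' Y Z x := by
  have e1 : (fun y ↦ g.inner y ((X + X') y) (Z y)) =
      fun y ↦ g.inner y (X y) (Z y) + g.inner y (X' y) (Z y) := by ext y; simp
  have e2 : (fun y ↦ g.inner y ((X + X') y) (Y y)) =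
      fun y ↦ g.inner y (X y) (Y y) + g.inner y (X' y) (Y y) := by ext y; simp
  have b1 := VectorField.mlieBracket_add_left (W := Y) hX hX'
  have b2 := VectorField.mlieBracket_add_left (W := Z) hX hX'
  simp only [koszul, dirDeriv, bracket, e1, e2, b1, b2,
    mvfderiv_fun_add (mdifferentiableAt_inner g hX hZ) (mdifferentiableAt_inner g hX' hZ),
    mvfderiv_fun_add (mdifferentiableAt_inner g hX hY) (mdifferentiableAt_inner g hX' hY)]
  simp
  ring

theorem koszul_smul_left (hf : MDifferentiableAt 𝓘(ℝ, E) 𝓘(ℝ, ℝ) f x) (hX : DiffAt X x)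
    (hY : DiffAt Y x) (hZ : DiffAt Z x) :
    koszul g (f • X) Y Z x = f x * koszul g X Y Z x := by
  have e1 : (fun y ↦ g.inner y ((f • X) y) (Z y)) =
      fun y ↦ f y * g.inner y (X y) (Z y) := by ext y; simp
  have e2 : (fun y ↦ g.inner y ((f • X) y) (Y y)) =
      fun y ↦ f y * g.inner y (X y) (Y y) := by ext y; simp
  have b1 := VectorField.mlieBracket_smul_left (W := Y) hf hX
  have b2 := VectorField.mlieBracket_smul_left (W := Z) hf hX
  simp only [koszul, dirDeriv, bracket, e1, e2, b1, b2,
    mvfderiv_fun_mul hf (mdifferentiableAt_inner g hX hZ),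
    mvfderiv_fun_mul hf (mdifferentiableAt_inner g hX hY)]
  simp
  ring

theorem koszul_add_right (hX : DiffAt X x) (hY : DiffAt Y x) (hY' : DiffAt Y' x)
    (hZ : DiffAt Z x) :
    koszul g X (Y + Y') Z x = koszul g X Y Z x + koszul g X Y' Z x := by
  have e1 : (fun y ↦ g.inner y ((Y + Y') y) (Z y)) =
      fun y ↦ g.inner y (Y y) (Z y) + g.inner y (Y' y) (Z y) := by ext y; simp
  have e2 : (fun y ↦ g.inner y (X y) ((Y + Y') y)) =
      fun y ↦ g.inner y (X y) (Y y) + g.inner y (X y) (Y' y) := by ext y; simp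
  have b1 := VectorField.mlieBracket_add_right (V := X) hY hY'
  have b2 := VectorField.mlieBracket_add_left (W := Z) hY hY'
  simp only [koszul, dirDeriv, bracket, e1, e2, b1, b2,
    mvfderiv_fun_add (mdifferentiableAt_inner g hY hZ) (mdifferentiableAt_inner g hY' hZ),
    mvfderiv_fun_add (mdifferentiableAt_inner g hX hY) (mdifferentiableAt_inner g hX hY')]
  simp
  ring

theorem koszul_smul_right (hf : MDifferentiableAt 𝓘(ℝ, E) 𝓘(ℝ, ℝ) f x) (hX : DiffAt X x)
    (hY : DiffAt Y x) (hZ : DiffAt Z x) :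
    koszul g X (f • Y) Z x =
      f x * koszul g X Y Z x + 2 * dirDeriv X f x * g.inner x (Y x) (Z x) := by
  have e1 : (fun y ↦ g.inner y ((f • Y) y) (Z y)) =
      fun y ↦ f y * g.inner y (Y y) (Z y) := by ext y; simp
  have e2 : (fun y ↦ g.inner y (X y) ((f • Y) y)) =
      fun y ↦ f y * g.inner y (X y) (Y y) := by ext y; simp
  have b1 := VectorField.mlieBracket_smul_right (V := X) hf hY
  have b2 := VectorField.mlieBracket_smul_left (W := Z) hf hY
  simp only [koszul, dirDeriv, bracket, e1, e2, b1, b2,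
    mvfderiv_fun_mul hf (mdifferentiableAt_inner g hY hZ),
    mvfderiv_fun_mul hf (mdifferentiableAt_inner g hX hY)]
  simp [g.symm x (Y x) (X x)]
  ring

end Pointwise

section FiniteDim

variable [FiniteDimensional ℝ E] (g : Metric E M) {X X' Y Y' Z : Field E M} {x : M} {f : M → ℝ}

theorem leviCivita_add_left_apply (hX : DiffAt X x) (hX' : DiffAt X' x) (hY : DiffAt Y x) :
    leviCivita g (X + X') Y x = leviCivita g X Y x + leviCivita g X' Y x := by
  have : CompleteSpace E := FiniteDimensional.complete ℝ E
  refine (eq_leviCivita g (hX.add hX') hY _ fun Z hZ ↦ ?_).symm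
  rw [koszul_add_left g hX hX' hY hZ, ← leviCivita_spec g hX hY hZ, ← leviCivita_spec g hX' hY hZ]
  simp
  ring

theorem leviCivita_smul_left_apply (hf : MDifferentiableAt 𝓘(ℝ, E) 𝓘(ℝ, ℝ) f x) (hX : DiffAt X x)
    (hY : DiffAt Y x) : leviCivita g (f • X) Y x = f x • leviCivita g X Y x := by
  have : CompleteSpace E := FiniteDimensional.complete ℝ E
  refine (eq_leviCivita g (DiffAt.smul hf hX) hY _ fun Z hZ ↦ ?_).symm
  rw [koszul_smul_left g hf hX hY hZ, ← leviCivita_spec g hX hY hZ]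
  simp
  ring

theorem leviCivita_add_right (hX : IsSmooth X) (hY : IsSmooth Y) (hY' : IsSmooth Y') :
    leviCivita g X (Y + Y') = leviCivita g X Y + leviCivita g X Y' := by
  have : CompleteSpace E := FiniteDimensional.complete ℝ E
  ext1 x
  have hX := hX.mdifferentiableAt x
  have hY := hY.mdifferentiableAt x
  have hY' := hY'.mdifferentiableAt x
  refine (eq_leviCivita g hX (DiffAt.add hY hY') _ fun Z hZ ↦ ?_).symm
  rw [koszul_add_right g hX hY hY' hZ, ← leviCivita_spec g hX hY hZ, ← leviCivita_spec g hX hY' hZ]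
  simp
  ring

/-- The Leibniz rule. -/
theorem leviCivita_smul_right (hf : ContMDiff 𝓘(ℝ, E) 𝓘(ℝ, ℝ) ∞ f) (hX : IsSmooth X)
    (hY : IsSmooth Y) :
    leviCivita g X (f • Y) = f • leviCivita g X Y + dirDeriv X f • Y := by
  have : CompleteSpace E := FiniteDimensional.complete ℝ E
  ext1 x
  have hX := hX.mdifferentiableAt x
  have hY := hY.mdifferentiableAt x
  have hf := (hf x).mdifferentiableAt (by simp)
  refine (eq_leviCivita g hX (DiffAt.smul hf hY) _ fun Z hZ ↦ ?_).symm
  rw [koszul_smul_right g hf hX hY hZ, ← leviCivita_spec g hX hY hZ]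
  simp
  ring

theorem leviCivita_add_left (hX : IsSmooth X) (hX' : IsSmooth X') (hY : IsSmooth Y) :
    leviCivita g (X + X') Y = leviCivita g X Y + leviCivita g X' Y :=
  funext fun x ↦ leviCivita_add_left_apply g (hX.mdifferentiableAt x) (hX'.mdifferentiableAt x)
    (hY.mdifferentiableAt x)

theorem leviCivita_smul_left (hf : ContMDiff 𝓘(ℝ, E) 𝓘(ℝ, ℝ) ∞ f) (hX : IsSmooth X)
    (hY : IsSmooth Y) : leviCivita g (f • X) Y = f • leviCivita g X Y :=
  funext fun x ↦ leviCivita_smul_left_apply g ((hf x).mdifferentiableAt (by simp))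
    (hX.mdifferentiableAt x) (hY.mdifferentiableAt x)

theorem leviCivita_const_smul_right (c : ℝ) (hX : IsSmooth X) (hY : IsSmooth Y) :
    leviCivita g X (c • Y) = c • leviCivita g X Y := by
  have := leviCivita_smul_right g (f := fun _ ↦ c) contMDiff_const hX hY
  have h0 : dirDeriv X (fun _ : M ↦ c) = 0 := by
    ext x
    rw [dirDeriv, mvfderiv_const]
    rfl
  rw [h0, zero_smul, add_zero] at this
  exact this

theorem leviCivita_neg_right (hX : IsSmooth X) (hY : IsSmooth Y) :
    leviCivita g X (-Y) = -leviCivita g X Y := by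
  simpa using leviCivita_const_smul_right g (-1) hX hY

omit [FiniteDimensional ℝ E] in
theorem dirDeriv_inner_comm : dirDeriv X (fun y ↦ g.inner y (Y y) (Z y)) =
    dirDeriv X (fun y ↦ g.inner y (Z y) (Y y)) := by
  simp only [g.symm]

/-- The Levi-Civita connection is metric. -/
theorem dirDeriv_inner (hX : IsSmooth X) (hY : IsSmooth Y) (hZ : IsSmooth Z) (x : M) :
    dirDeriv X (fun y ↦ g.inner y (Y y) (Z y)) x =
      g.inner x (leviCivita g X Y x) (Z x) + g.inner x (Y x) (leviCivita g X Z x) := by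
  have h1 := leviCivita_spec g (hX.mdifferentiableAt x) (hY.mdifferentiableAt x)
    (hZ.mdifferentiableAt x)
  have h2 := leviCivita_spec g (hX.mdifferentiableAt x) (hZ.mdifferentiableAt x)
    (hY.mdifferentiableAt x)
  have h3 : g.inner x (bracket Z Y x) (X x) = -g.inner x (bracket Y Z x) (X x) := by
    rw [show bracket Z Y x = -bracket Y Z x from VectorField.mlieBracket_swap_apply, g.symm,
      map_neg, g.symm]
  rw [koszul] at h1 h2
  rw [dirDeriv_inner_comm g (Y := Z) (Z := Y), h3] at h2
  rw [g.symm x (Y x)]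
  linarith

variable [T2Space M]

/-- The Levi-Civita connection is torsion free. -/
theorem bracket_eq (hX : IsSmooth X) (hY : IsSmooth Y) :
    bracket X Y = leviCivita g X Y - leviCivita g Y X := by
  ext1 x
  refine eq_of_inner_eq g fun Z hZ ↦ ?_
  have h1 := leviCivita_spec g (hX.mdifferentiableAt x) (hY.mdifferentiableAt x)
    (hZ.mdifferentiableAt x)
  have h2 := leviCivita_spec g (hY.mdifferentiableAt x) (hX.mdifferentiableAt x)
    (hZ.mdifferentiableAt x)
  have h3 : g.inner x (bracket Y X x) (Z x) = -g.inner x (bracket X Y x) (Z x) := by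
    rw [show bracket Y X x = -bracket X Y x from VectorField.mlieBracket_swap_apply, g.symm,
      map_neg, g.symm]
  rw [koszul] at h1 h2
  rw [dirDeriv_inner_comm g (Y := Y) (Z := X), h3] at h2
  rw [Pi.sub_apply, map_sub, _root_.sub_apply]
  linarith

theorem IsSmooth.leviCivita (hX : IsSmooth X) (hY : IsSmooth Y) : IsSmooth (leviCivita g X Y) := by
  have : CompleteSpace E := FiniteDimensional.complete ℝ E
  refine isSmooth_of_inner g fun Z hZ ↦ ?_
  have : (fun x ↦ g.inner x (AlmostContact.leviCivita g X Y x) (Z x)) =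
      fun x ↦ (1 / 2 : ℝ) * koszul g X Y Z x := by
    ext x
    rw [← leviCivita_spec g (hX.mdifferentiableAt x) (hY.mdifferentiableAt x)
      (hZ.mdifferentiableAt x)]
    ring
  rw [this]
  refine contMDiff_const.mul ?_
  unfold koszul
  exact (((((contMDiff_dirDeriv (hY.inner g hZ) hX).add (contMDiff_dirDeriv (hX.inner g hZ) hY)).sub
    (contMDiff_dirDeriv (hX.inner g hY) hZ)).add ((hX.bracket hY).inner g hZ)).sub
    ((hX.bracket hZ).inner g hY)).sub ((hY.bracket hZ).inner g hX)

end FiniteDim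

end LeviCivita

namespace AlmostContactMetric

variable {E : Type*} [NormedAddCommGroup E] [NormedSpace ℝ E]
  {M : Type*} [TopologicalSpace M] [ChartedSpace E M] [IsManifold 𝓘(ℝ, E) ∞ M]
  (S : AlmostContactMetric E M)

/-! ### Algebra of almost contact metric structures -/

section Algebra

variable (x : M) (v w : TangentSpace 𝓘(ℝ, E) x)

theorem φ_ξ : S.φ x (S.ξ x) = 0 := by
  have h1 : S.φ x (S.φ x (S.ξ x)) = 0 := by rw [S.φ_sq, S.η_ξ, one_smul, neg_add_cancel]
  have h2 := S.φ_sq x (S.φ x (S.ξ x))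
  rw [h1, map_zero] at h2
  have h3 : S.φ x (S.ξ x) = S.η x (S.φ x (S.ξ x)) • S.ξ x := by
    rw [eq_comm, ← sub_eq_zero, sub_eq_neg_add]; exact h2.symm
  by_cases h0 : S.η x (S.φ x (S.ξ x)) = 0
  · rwa [h0, zero_smul] at h3
  · have h4 := congrArg (S.φ x) h3
    rw [h1, map_smul] at h4
    exact (smul_eq_zero.1 h4.symm).resolve_left h0

theorem ξ_ne_zero : S.ξ x ≠ 0 := fun h ↦ by
  have := S.η_ξ x
  rw [h, map_zero] at this
  exact zero_ne_one this

theorem η_φ : S.η x (S.φ x v) = 0 := by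
  have h1 := S.φ_sq x (S.φ x v)
  rw [S.φ_sq x v, map_add, map_neg, map_smul, φ_ξ, smul_zero, add_zero, left_eq_add] at h1
  exact (smul_eq_zero.1 h1).resolve_right (S.ξ_ne_zero x)

theorem inner_ξ : S.g.inner x v (S.ξ x) = S.η x v := by
  have := S.compatible x v (S.ξ x)
  rw [φ_ξ, map_zero, S.η_ξ, mul_one] at this
  linarith

theorem inner_φ : S.g.inner x (S.φ x v) w = -S.g.inner x v (S.φ x w) := by
  have := S.compatible x v (S.φ x w)
  rw [η_φ, mul_zero, sub_zero, S.φ_sq, map_add, map_neg, map_smul, inner_ξ, η_φ, smul_zero,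
    add_zero] at this
  linarith

end Algebra

theorem smooth_act {X : Field E M} (hX : IsSmooth X) : IsSmooth (S.φ.act X) := hX.act S.smooth_φ

variable [FiniteDimensional ℝ E]

/-! ### The covariant derivative of the characteristic field -/

theorem tensorialAt_nablaXi (x : M) :
    TensorialAt 𝓘(ℝ, E) E (fun X : Field E M ↦ leviCivita S.g X S.ξ x) x where
  smul hf hX := leviCivita_smul_left_apply S.g hf hX (S.smooth_ξ.mdifferentiableAt x)
  add hX hY := leviCivita_add_left_apply S.g hX hY (S.smooth_ξ.mdifferentiableAt x)

/-- The endomorphism `v ↦ ∇_v ξ` of the tangent space at `x`. -/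
noncomputable def nablaXi : EndField E M := fun x ↦ TensorialAt.mkHom _ x (S.tensorialAt_nablaXi x)

variable {S} {X Y Z : Field E M} {x : M} {α : ℝ}

theorem nablaXi_apply (hX : IsSmooth X) (x : M) :
    S.nablaXi x (X x) = leviCivita S.g X S.ξ x :=
  TensorialAt.mkHom_apply (S.tensorialAt_nablaXi x) (hX.mdifferentiableAt x)

theorem leviCivita_ξ (hX : IsSmooth X) : leviCivita S.g X S.ξ = S.nablaXi.act X :=
  funext fun x ↦ (nablaXi_apply hX x).symm

omit [IsManifold 𝓘(ℝ, E) ∞ M] [FiniteDimensional ℝ E] in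
theorem dirDeriv_const (X : Field E M) (c : ℝ) (x : M) : dirDeriv X (fun _ : M ↦ c) x = 0 := by
  rw [dirDeriv, mvfderiv_const]
  rfl

variable [T2Space M]

variable (S) in
theorem η_nablaXi (x : M) (v : TangentSpace 𝓘(ℝ, E) x) : S.η x (S.nablaXi x v) = 0 := by
  obtain ⟨X, hX, rfl⟩ := exists_isSmooth_apply_eq x v
  have h := dirDeriv_inner S.g hX S.smooth_ξ S.smooth_ξ x
  have h1 : (fun y ↦ S.g.inner y (S.ξ y) (S.ξ y)) = fun _ ↦ (1 : ℝ) := by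
    ext y
    rw [inner_ξ, S.η_ξ]
  rw [h1, dirDeriv_const, S.g.symm x (S.ξ x), inner_ξ, ← nablaXi_apply hX] at h
  linarith

omit [T2Space M] in
theorem dirDeriv_η (hX : IsSmooth X) (hY : IsSmooth Y) (x : M) :
    dirDeriv X (fun y ↦ S.η y (Y y)) x =
      S.η x (leviCivita S.g X Y x) + S.g.inner x (Y x) (S.nablaXi x (X x)) := by
  simp only [← S.inner_ξ]
  rw [dirDeriv_inner S.g hX hY S.smooth_ξ x, nablaXi_apply hX]

/-- As `η` is closed, `∇ξ` is symmetric. -/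
theorem nablaXi_symm (hS : S.IsAlmostCosymplectic α) (x : M) (v w : TangentSpace 𝓘(ℝ, E) x) :
    S.g.inner x (S.nablaXi x v) w = S.g.inner x v (S.nablaXi x w) := by
  obtain ⟨X, hX, rfl⟩ := exists_isSmooth_apply_eq x v
  obtain ⟨Y, hY, rfl⟩ := exists_isSmooth_apply_eq x w
  have h := congrFun (hS.d_η X Y hX hY) x
  rw [extDerivOne, dirDeriv_η hX hY, dirDeriv_η hY hX, bracket_eq S.g hX hY, Pi.sub_apply, map_sub,
    Pi.zero_apply] at h
  rw [S.g.symm x (S.nablaXi x _)]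
  linarith

theorem nablaXi_ξ (hS : S.IsAlmostCosymplectic α) (x : M) : S.nablaXi x (S.ξ x) = 0 := by
  refine eq_of_inner_eq S.g fun Z _ ↦ ?_
  rw [nablaXi_symm hS, S.g.symm, inner_ξ, η_nablaXi, map_zero, _root_.zero_apply]

/-! ### The covariant derivative of `φ` -/

variable (S) in
/-- The trilinear form `g((∇_X φ) Y, Z)`. -/
noncomputable def nablaPhi (X Y Z : Field E M) (x : M) : ℝ :=
  S.g.inner x (covDerivEnd S.g S.φ.act X Y x) (Z x)

omit [FiniteDimensional ℝ E] [T2Space M] in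
theorem covDerivEnd_φ_apply (X Y : Field E M) (x : M) : covDerivEnd S.g S.φ.act X Y x =
    leviCivita S.g X (S.φ.act Y) x - S.φ x (leviCivita S.g X Y x) := rfl

omit [FiniteDimensional ℝ E] [T2Space M] in
theorem nablaPhi_eq (X Y Z : Field E M) (x : M) : S.nablaPhi X Y Z x =
    S.g.inner x (leviCivita S.g X (S.φ.act Y) x) (Z x) +
      S.g.inner x (leviCivita S.g X Y x) (S.φ x (Z x)) := by
  rw [nablaPhi, covDerivEnd_φ_apply, map_sub, _root_.sub_apply, inner_φ, sub_neg_eq_add]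

omit [T2Space M] in
theorem nablaPhi_swap (hX : IsSmooth X) (hY : IsSmooth Y) (hZ : IsSmooth Z) (x : M) :
    S.nablaPhi X Y Z x = -S.nablaPhi X Z Y x := by
  have h1 := dirDeriv_inner S.g hX (S.smooth_act hY) hZ x
  have h2 := dirDeriv_inner S.g hX (S.smooth_act hZ) hY x
  have h3 : (fun y ↦ S.g.inner y (S.φ.act Y y) (Z y)) =
      -(fun y ↦ S.g.inner y (S.φ.act Z y) (Y y)) := by
    ext y
    rw [Pi.neg_apply, EndField.act, inner_φ, S.g.symm]
    rfl
  rw [h3, dirDeriv, mvfderiv_neg, _root_.neg_apply] at h1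
  rw [dirDeriv] at h2
  rw [nablaPhi_eq, nablaPhi_eq, S.g.symm x _ (S.φ x (Z x)), S.g.symm x _ (S.φ x (Y x))]
  simp only [EndField.act] at *
  linarith

omit [T2Space M] in
/-- Differentiating `φ² = -1 + η ⊗ ξ`. -/
theorem covDerivEnd_φ_act (hX : IsSmooth X) (hY : IsSmooth Y) (x : M) :
    covDerivEnd S.g S.φ.act X (S.φ.act Y) x + S.φ x (covDerivEnd S.g S.φ.act X Y x) =
      S.g.inner x (Y x) (S.nablaXi x (X x)) • S.ξ x + S.η x (Y x) • S.nablaXi x (X x) := by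
  have h1 : S.φ.act (S.φ.act Y) = -Y + (fun y ↦ S.η y (Y y)) • S.ξ :=
    funext fun y ↦ S.φ_sq y (Y y)
  have hη := hY.form_apply S.smooth_η
  rw [covDerivEnd_φ_apply, covDerivEnd_φ_apply, h1,
    leviCivita_add_right S.g hX hY.neg (S.smooth_ξ.smul hη), leviCivita_neg_right S.g hX hY,
    leviCivita_smul_right S.g hη hX S.smooth_ξ, map_sub, S.φ_sq, leviCivita_ξ hX]
  simp only [Pi.add_apply, Pi.neg_apply, Pi.smul_apply', dirDeriv_η hX hY, EndField.act]
  module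

omit [T2Space M] in
theorem covDerivEnd_φ_ξ (hX : IsSmooth X) (x : M) :
    covDerivEnd S.g S.φ.act X S.ξ x = -S.φ x (S.nablaXi x (X x)) := by
  have h1 : S.φ.act S.ξ = (0 : ℝ) • S.ξ := funext fun y ↦ by
    rw [EndField.act, φ_ξ, Pi.smul_apply, zero_smul]
  rw [covDerivEnd_φ_apply, h1, leviCivita_const_smul_right S.g 0 hX S.smooth_ξ, nablaXi_apply hX]
  simp

/-- The exterior derivative of the fundamental form is the cyclic sum of `g((∇_X φ) Y, Z)`. -/
theorem extDerivTwo_fundForm (hX : IsSmooth X) (hY : IsSmooth Y) (hZ : IsSmooth Z) (x : M) :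
    extDerivTwo (fundForm S.φ S.g) X Y Z x =
      S.nablaPhi X Y Z x + S.nablaPhi Y Z X x + S.nablaPhi Z X Y x := by
  have h1 := dirDeriv_inner S.g hX (S.smooth_act hY) hZ x
  have h2 := dirDeriv_inner S.g hY (S.smooth_act hZ) hX x
  have h3 := dirDeriv_inner S.g hZ (S.smooth_act hX) hY x
  simp only [extDerivTwo, fundForm, nablaPhi_eq, bracket_eq S.g hX hY, bracket_eq S.g hY hZ,
    bracket_eq S.g hZ hX, Pi.sub_apply, map_sub, _root_.sub_apply] at *
  simp only [EndField.act] at *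
  change dirDeriv X (fun y ↦ S.g.inner y (S.φ y (Y y)) (Z y)) x +
    dirDeriv Y (fun y ↦ S.g.inner y (S.φ y (Z y)) (X y)) x +
    dirDeriv Z (fun y ↦ S.g.inner y (S.φ y (X y)) (Y y)) x - _ - _ - _ = _
  rw [h1, h2, h3]
  have k1 := S.inner_φ x (leviCivita S.g X Y x) (Z x)
  have k2 := S.inner_φ x (leviCivita S.g Y X x) (Z x)
  have k3 := S.inner_φ x (leviCivita S.g Y Z x) (X x)
  have k4 := S.inner_φ x (leviCivita S.g Z Y x) (X x)
  have k5 := S.inner_φ x (leviCivita S.g Z X x) (Y x)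
  have k6 := S.inner_φ x (leviCivita S.g X Z x) (Y x)
  have s1 := S.g.symm x (S.φ x (Y x)) (leviCivita S.g X Z x)
  have s2 := S.g.symm x (S.φ x (Z x)) (leviCivita S.g Y X x)
  have s3 := S.g.symm x (S.φ x (X x)) (leviCivita S.g Z Y x)
  linarith

/-! ### Almost cosymplectic structures -/

section Cosymplectic

variable (hS : S.IsAlmostCosymplectic α)

include hS

theorem nablaPhi_cyclic (hX : IsSmooth X) (hY : IsSmooth Y) (hZ : IsSmooth Z) (x : M) :
    S.nablaPhi X Y Z x + S.nablaPhi Y Z X x + S.nablaPhi Z X Y x =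
      2 * α * wedgeOneTwo S.η (fundForm S.φ S.g) X Y Z x := by
  rw [← hS.d_fundForm X Y Z hX hY hZ, extDerivTwo_fundForm hX hY hZ]

theorem covDerivEnd_φ_ξ_left_eq (hY : IsSmooth Y) (x : M) :
    covDerivEnd S.g S.φ.act S.ξ Y x = (2 * α) • S.φ x (Y x) - S.φ x (S.nablaXi x (Y x))
      - S.nablaXi x (S.φ x (Y x)) := by
  refine eq_of_inner_eq S.g fun Z hZ ↦ ?_
  have h1 := nablaPhi_cyclic hS S.smooth_ξ hY hZ x
  rw [nablaPhi_swap hY hZ S.smooth_ξ] at h1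
  simp only [nablaPhi, covDerivEnd_φ_ξ hY, covDerivEnd_φ_ξ hZ, wedgeOneTwo, fundForm, φ_ξ, S.η_ξ,
    inner_ξ, η_φ, map_neg, map_zero, _root_.zero_apply, _root_.neg_apply] at h1
  rw [S.inner_φ x (S.nablaXi x (Z x)), nablaXi_symm hS, S.g.symm x (Z x)] at h1
  simp only [map_sub, _root_.sub_apply, map_smul, _root_.smul_apply, smul_eq_mul]
  linarith

/-- The endomorphism `∇_ξ φ` anticommutes with `φ`, whereas its expression in terms of `∇ξ` and
`φ` commutes with `φ`. Hence it vanishes. -/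
theorem φ_nablaXi (x : M) (v : TangentSpace 𝓘(ℝ, E) x) :
    S.φ x (S.nablaXi x v) = (2 * α) • S.φ x v - S.nablaXi x (S.φ x v) := by
  obtain ⟨Y, hY, rfl⟩ := exists_isSmooth_apply_eq x v
  have h := covDerivEnd_φ_act (S := S) S.smooth_ξ hY x
  rw [covDerivEnd_φ_ξ_left_eq hS hY, covDerivEnd_φ_ξ_left_eq hS (S.smooth_act hY), nablaXi_ξ hS,
    map_zero, smul_zero, zero_smul, add_zero] at h
  simp only [EndField.act, map_sub, map_smul, map_add, map_neg, φ_sq, η_nablaXi, nablaXi_ξ hS,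
    smul_zero, zero_smul, add_zero] at h
  have h2 : (2 : ℝ) • S.nablaXi x (Y x) = (2 : ℝ) • S.φ x (S.nablaXi x (S.φ x (Y x)))
      - (4 * α) • (-Y x + S.η x (Y x) • S.ξ x) := by
    rw [← sub_eq_zero, ← h]
    module
  have h3 := congrArg (S.φ x) h2
  simp only [map_sub, map_smul, map_add, map_neg, φ_sq, η_nablaXi, φ_ξ, smul_zero, zero_smul,
    add_zero] at h3
  have h4 := congrArg (fun v ↦ (1 / 2 : ℝ) • v) h3
  simp only [smul_sub, smul_neg, smul_smul] at h4
  norm_num at h4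
  rw [h4]
  module

theorem covDerivEnd_φ_ξ_left (hY : IsSmooth Y) (x : M) :
    covDerivEnd S.g S.φ.act S.ξ Y x = 0 := by
  rw [covDerivEnd_φ_ξ_left_eq hS hY, φ_nablaXi hS]
  module

end Cosymplectic

variable (S α) in
/-- The tensor field `h = φ ∘ ∇ξ - α φ`, as a field of endomorphisms. -/
noncomputable def hEnd : EndField E M := fun x ↦ S.φ x ∘L S.nablaXi x - α • S.φ x

omit [T2Space M] in
theorem hEnd_apply (x : M) (v : TangentSpace 𝓘(ℝ, E) x) :
    S.hEnd α x v = S.φ x (S.nablaXi x v) - α • S.φ x v := rfl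

section Cosymplectic

variable (hS : S.IsAlmostCosymplectic α)

include hS

theorem h_eq (hX : IsSmooth X) : S.h X = (S.hEnd α).act X := by
  ext1 x
  have h1 := covDerivEnd_φ_ξ_left hS hX x
  rw [covDerivEnd_φ_apply] at h1
  have h2 := nablaXi_apply (S := S) hX x
  have h3 := nablaXi_apply (S := S) (S.smooth_act hX) x
  have h4 := φ_nablaXi hS x (X x)
  simp only [AlmostContactMetric.h, lieDerivEnd, Pi.smul_apply, Pi.sub_apply, EndField.act,
    bracket_eq S.g S.smooth_ξ (S.smooth_act hX), bracket_eq S.g S.smooth_ξ hX, map_sub,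
    hEnd_apply] at *
  rw [← h2, ← h3, sub_eq_zero.1 h1, h4]
  module

theorem hEnd_ξ (x : M) : S.hEnd α x (S.ξ x) = 0 := by
  rw [hEnd_apply, nablaXi_ξ hS, φ_ξ, map_zero, smul_zero, sub_zero]

omit [T2Space M] hS in
theorem η_hEnd (x : M) (v : TangentSpace 𝓘(ℝ, E) x) : S.η x (S.hEnd α x v) = 0 := by
  rw [hEnd_apply, map_sub, map_smul, η_φ, η_φ, smul_zero, sub_zero]

omit hS in
theorem φ_hEnd (x : M) (v : TangentSpace 𝓘(ℝ, E) x) :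
    S.φ x (S.hEnd α x v) = -S.nablaXi x v - α • S.φ x (S.φ x v) := by
  rw [hEnd_apply, map_sub, map_smul, φ_sq _ _ (S.nablaXi x v), η_nablaXi, zero_smul, add_zero]

theorem hEnd_φ (x : M) (v : TangentSpace 𝓘(ℝ, E) x) :
    S.hEnd α x (S.φ x v) = -S.φ x (S.hEnd α x v) := by
  rw [hEnd_apply, φ_nablaXi hS, φ_hEnd, S.φ_sq x v, map_add, map_neg, map_smul, nablaXi_ξ hS]
  module

theorem hEnd_symm (x : M) (v w : TangentSpace 𝓘(ℝ, E) x) :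
    S.g.inner x (S.hEnd α x v) w = S.g.inner x v (S.hEnd α x w) := by
  rw [hEnd_apply, φ_nablaXi hS, hEnd_apply]
  simp only [map_sub, map_smul, _root_.sub_apply, _root_.smul_apply, nablaXi_symm hS, inner_φ,
    smul_eq_mul]
  ring

theorem A_eq (hX : IsSmooth X) : S.A α X = -S.nablaXi.act X := by
  ext1 x
  rw [AlmostContactMetric.A, h_eq hS hX]
  simp only [Pi.add_apply, Pi.smul_apply, Pi.neg_apply, EndField.act, φ_hEnd]
  module

omit hS in
theorem smooth_hEnd (hX : IsSmooth X) : IsSmooth ((S.hEnd α).act X) := by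
  have h1 := S.smooth_act (hX.leviCivita S.g S.smooth_ξ)
  rw [leviCivita_ξ hX] at h1
  exact h1.sub ((S.smooth_act hX).const_smul α)

end Cosymplectic

end AlmostContactMetric

section CovDerivEnd

variable {E : Type*} [NormedAddCommGroup E] [NormedSpace ℝ E] [FiniteDimensional ℝ E]
  {M : Type*} [TopologicalSpace M] [ChartedSpace E M] [IsManifold 𝓘(ℝ, E) ∞ M]
  (g : Metric E M) {T : EndField E M} {X X' Y Y' : Field E M} {f : M → ℝ}

/-! ### Covariant derivatives of endomorphism fields -/

omit [FiniteDimensional ℝ E] [IsManifold 𝓘(ℝ, E) ∞ M] in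
theorem EndField.act_add (T : EndField E M) (X Y : Field E M) :
    T.act (X + Y) = T.act X + T.act Y := funext fun x ↦ map_add (T x) _ _

omit [FiniteDimensional ℝ E] [IsManifold 𝓘(ℝ, E) ∞ M] in
theorem EndField.act_smul (T : EndField E M) (f : M → ℝ) (X : Field E M) :
    T.act (f • X) = f • T.act X := funext fun x ↦ map_smul (T x) _ _

theorem covDerivEnd_add_left (hT : ∀ {X}, IsSmooth X → IsSmooth (T.act X)) (hX : IsSmooth X)
    (hX' : IsSmooth X') (hY : IsSmooth Y) :
    covDerivEnd g T.act (X + X') Y = covDerivEnd g T.act X Y + covDerivEnd g T.act X' Y := by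
  rw [covDerivEnd, leviCivita_add_left g hX hX' (hT hY), leviCivita_add_left g hX hX' hY,
    EndField.act_add, covDerivEnd, covDerivEnd]
  abel

theorem covDerivEnd_smul_left (hT : ∀ {X}, IsSmooth X → IsSmooth (T.act X))
    (hf : ContMDiff 𝓘(ℝ, E) 𝓘(ℝ, ℝ) ∞ f) (hX : IsSmooth X) (hY : IsSmooth Y) :
    covDerivEnd g T.act (f • X) Y = f • covDerivEnd g T.act X Y := by
  rw [covDerivEnd, leviCivita_smul_left g hf hX (hT hY), leviCivita_smul_left g hf hX hY,
    EndField.act_smul, covDerivEnd]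
  ext1 x
  exact (smul_sub _ _ _).symm

theorem covDerivEnd_add_right (hT : ∀ {X}, IsSmooth X → IsSmooth (T.act X)) (hX : IsSmooth X)
    (hY : IsSmooth Y) (hY' : IsSmooth Y') :
    covDerivEnd g T.act X (Y + Y') = covDerivEnd g T.act X Y + covDerivEnd g T.act X Y' := by
  rw [covDerivEnd, EndField.act_add, leviCivita_add_right g hX (hT hY) (hT hY'),
    leviCivita_add_right g hX hY hY', EndField.act_add, covDerivEnd, covDerivEnd]
  abel

theorem covDerivEnd_smul_right (hT : ∀ {X}, IsSmooth X → IsSmooth (T.act X))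
    (hf : ContMDiff 𝓘(ℝ, E) 𝓘(ℝ, ℝ) ∞ f) (hX : IsSmooth X) (hY : IsSmooth Y) :
    covDerivEnd g T.act X (f • Y) = f • covDerivEnd g T.act X Y := by
  rw [covDerivEnd, EndField.act_smul, leviCivita_smul_right g hf hX (hT hY),
    leviCivita_smul_right g hf hX hY, EndField.act_add, EndField.act_smul, EndField.act_smul,
    covDerivEnd, add_sub_add_right_eq_sub]
  ext1 x
  exact (smul_sub _ _ _).symm

end CovDerivEnd

namespace AlmostContactMetric

variable {E : Type*} [NormedAddCommGroup E] [NormedSpace ℝ E] [FiniteDimensional ℝ E]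
  {M : Type*} [TopologicalSpace M] [T2Space M] [ChartedSpace E M] [IsManifold 𝓘(ℝ, E) ∞ M]
  {S : AlmostContactMetric E M} {X Y Z : Field E M} {x : M} {α : ℝ}

variable (S) in
/-! ### Horizontal vector fields -/

/-- The component of a vector field in the distribution `ker η`. -/
noncomputable def horizontal (X : Field E M) : Field E M := X - (fun x ↦ S.η x (X x)) • S.ξ

omit [T2Space M] [FiniteDimensional ℝ E] in
theorem horizontal_apply (X : Field E M) (x : M) :
    S.horizontal X x = X x - S.η x (X x) • S.ξ x := rfl

omit [T2Space M] [FiniteDimensional ℝ E] in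
theorem horizontal_add (X : Field E M) :
    S.horizontal X + (fun x ↦ S.η x (X x)) • S.ξ = X := sub_add_cancel _ _

omit [T2Space M] [FiniteDimensional ℝ E] in
theorem smooth_horizontal (hX : IsSmooth X) : IsSmooth (S.horizontal X) :=
  hX.sub (S.smooth_ξ.smul (hX.form_apply S.smooth_η))

omit [T2Space M] [FiniteDimensional ℝ E] in
theorem η_horizontal (X : Field E M) (x : M) : S.η x (S.horizontal X x) = 0 := by
  rw [horizontal_apply, map_sub, map_smul, S.η_ξ, smul_eq_mul, mul_one, sub_self]

/-- If `T ξ = 0`, `η ∘ T = 0`, `∇_ξ T = 0` and `T` is `η`-parallel, then `∇ T` is determined by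
`T` and `∇ξ`. -/
theorem covDerivEnd_eq_of_isEtaParallel (hS : S.IsAlmostCosymplectic α) {T : EndField E M}
    (hT : ∀ {X}, IsSmooth X → IsSmooth (T.act X)) (hTξ : ∀ x, T x (S.ξ x) = 0)
    (hηT : ∀ x v, S.η x (T x v) = 0)
    (hξ : ∀ Y, IsSmooth Y → covDerivEnd S.g T.act S.ξ Y = 0) (hp : S.IsEtaParallel T.act)
    (hX : IsSmooth X) (hY : IsSmooth Y) (x : M) :
    covDerivEnd S.g T.act X Y x = -S.g.inner x (T x (Y x)) (S.nablaXi x (X x)) • S.ξ x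
      - S.η x (Y x) • T x (S.nablaXi x (X x)) := by
  -- the component along `ξ`
  have h1 : ∀ {X Y}, IsSmooth X → IsSmooth Y → S.η x (covDerivEnd S.g T.act X Y x) =
      -S.g.inner x (T x (Y x)) (S.nablaXi x (X x)) := fun {X Y} hX hY ↦ by
    have h := dirDeriv_η (S := S) hX (hT hY) x
    simp only [EndField.act, hηT, dirDeriv_const] at h
    rw [covDerivEnd, Pi.sub_apply, map_sub]
    simp only [EndField.act, hηT]
    change 0 = S.η x (leviCivita S.g X (T.act Y) x) + _ at h
    linarith
  -- the value at `ξ`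
  have h2 : ∀ {X}, IsSmooth X → covDerivEnd S.g T.act X S.ξ x = -T x (S.nablaXi x (X x)) :=
    fun {X} hX ↦ by
      have h : T.act S.ξ = (0 : ℝ) • S.ξ := funext fun y ↦ by
        rw [EndField.act, hTξ, Pi.smul_apply, zero_smul]
      rw [covDerivEnd, h, leviCivita_const_smul_right S.g 0 hX S.smooth_ξ, Pi.sub_apply,
        EndField.act, ← nablaXi_apply hX]
      simp
  have hX' := smooth_horizontal (S := S) hX
  have hY' := smooth_horizontal (S := S) hY
  have hηX := hX.form_apply S.smooth_η
  have hηY := hY.form_apply S.smooth_η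
  have h3 : covDerivEnd S.g T.act X Y x =
      covDerivEnd S.g T.act (S.horizontal X) (S.horizontal Y) x +
        S.η x (Y x) • covDerivEnd S.g T.act (S.horizontal X) S.ξ x := by
    conv_lhs => rw [← S.horizontal_add X, covDerivEnd_add_left S.g hT hX' (S.smooth_ξ.smul hηX) hY,
      covDerivEnd_smul_left S.g hT hηX S.smooth_ξ hY, hξ Y hY, smul_zero, add_zero,
      ← S.horizontal_add Y, covDerivEnd_add_right S.g hT hX' hY' (S.smooth_ξ.smul hηY),
      covDerivEnd_smul_right S.g hT hηY hX' S.smooth_ξ]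
    rfl
  have hBX : S.nablaXi x (S.horizontal X x) = S.nablaXi x (X x) := by
    rw [horizontal_apply, map_sub, map_smul, nablaXi_ξ hS, smul_zero, sub_zero]
  have hTY : T x (S.horizontal Y x) = T x (Y x) := by
    rw [horizontal_apply, map_sub, map_smul, hTξ, smul_zero, sub_zero]
  refine eq_of_inner_eq S.g fun Z hZ ↦ ?_
  have h4 := hp _ _ _ hX' hY' (smooth_horizontal (S := S) hZ) (η_horizontal X) (η_horizontal Y)
    (η_horizontal Z) x
  rw [horizontal_apply, map_sub, map_smul, inner_ξ, h1 hX' hY', hBX, hTY] at h4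
  rw [h3, h2 hX', hBX, map_add, map_sub, map_smul, map_smul, map_smul, map_neg, _root_.add_apply,
    _root_.sub_apply, _root_.smul_apply, _root_.smul_apply, _root_.smul_apply, _root_.neg_apply,
    sub_eq_zero.1 h4, S.g.symm x (S.ξ x), inner_ξ]
  simp only [smul_eq_mul]
  ring

/-! ### The curvature of planes containing the characteristic field -/

section Cosymplectic

variable (hS : S.IsAlmostCosymplectic α)

include hS

theorem covDerivEnd_h (hX : IsSmooth X) (hY : IsSmooth Y) :
    covDerivEnd S.g S.h X Y = covDerivEnd S.g (S.hEnd α).act X Y := by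
  rw [covDerivEnd, covDerivEnd, h_eq hS hY, h_eq hS (hX.leviCivita S.g hY)]

omit hS in
theorem nablaXi_act_eq (X : Field E M) :
    S.nablaXi.act X = -(α • S.φ.act (S.φ.act X) + S.φ.act ((S.hEnd α).act X)) := by
  ext1 x
  simp only [Pi.neg_apply, Pi.add_apply, Pi.smul_apply, EndField.act, φ_hEnd]
  module

theorem curvature_ξ_ξ
    (h_xi : ∀ Y : Field E M, IsSmooth Y → covDerivEnd S.g S.h S.ξ Y = 0) (hX : IsSmooth X) :
    curvature S.g X S.ξ S.ξ = -S.nablaXi.act (S.nablaXi.act X) := by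
  have hφ : ∀ {Y}, IsSmooth Y →
      leviCivita S.g S.ξ (S.φ.act Y) = S.φ.act (leviCivita S.g S.ξ Y) := fun {Y} hY ↦
    funext fun x ↦ sub_eq_zero.1 (covDerivEnd_φ_ξ_left hS hY x)
  have hh : ∀ {Y}, IsSmooth Y →
      leviCivita S.g S.ξ ((S.hEnd α).act Y) = (S.hEnd α).act (leviCivita S.g S.ξ Y) :=
    fun {Y} hY ↦ by
      have := h_xi Y hY
      rw [covDerivEnd_h hS S.smooth_ξ hY] at this
      exact sub_eq_zero.1 this
  have hB : leviCivita S.g S.ξ (S.nablaXi.act X) = S.nablaXi.act (leviCivita S.g S.ξ X) := by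
    have h1 := S.smooth_act hX
    have h2 : IsSmooth ((S.hEnd α).act X) := smooth_hEnd hX
    rw [nablaXi_act_eq (α := α) X, nablaXi_act_eq (α := α) (leviCivita S.g S.ξ X),
      leviCivita_neg_right S.g S.smooth_ξ (((S.smooth_act h1).const_smul α).add (S.smooth_act h2)),
      leviCivita_add_right S.g S.smooth_ξ ((S.smooth_act h1).const_smul α) (S.smooth_act h2),
      leviCivita_const_smul_right S.g α S.smooth_ξ (S.smooth_act h1), hφ h1, hφ hX, hφ h2, hh hX]
  have h0 : leviCivita S.g S.ξ S.ξ = (0 : ℝ) • S.ξ := by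
    rw [leviCivita_ξ S.smooth_ξ]
    ext1 x
    rw [EndField.act, nablaXi_ξ hS, Pi.smul_apply, zero_smul]
  have hXξ : IsSmooth (bracket X S.ξ) := by
    rw [bracket_eq S.g hX S.smooth_ξ]
    exact (hX.leviCivita S.g S.smooth_ξ).sub (S.smooth_ξ.leviCivita S.g hX)
  rw [curvature, h0, leviCivita_const_smul_right S.g 0 hX S.smooth_ξ, zero_smul, leviCivita_ξ hX,
    hB, leviCivita_ξ hXξ, bracket_eq S.g hX S.smooth_ξ, leviCivita_ξ hX]
  ext1 x
  simp only [EndField.act, Pi.sub_apply, Pi.neg_apply, Pi.zero_apply, map_sub]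
  abel

/-- If `h v = 0` for some non-zero `v` orthogonal to `ξ`, then the plane spanned by `v` and `ξ` has
sectional curvature `-α²`. -/
theorem eq_zero_of_hEnd_eq_zero
    (h_xi : ∀ Y : Field E M, IsSmooth Y → covDerivEnd S.g S.h S.ξ Y = 0)
    (h_curv : S.XiSectionalCurvatureNeAt (-α ^ 2) x) {v : TangentSpace 𝓘(ℝ, E) x}
    (hv : S.η x v = 0) (hhv : S.hEnd α x v = 0) : v = 0 := by
  by_contra hv0
  obtain ⟨X, hX, rfl⟩ := exists_isSmooth_apply_eq x v
  have hB : S.nablaXi x (X x) = α • X x := by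
    have h := S.φ_hEnd (α := α) x (X x)
    rw [hhv, map_zero, φ_sq, hv, zero_smul, add_zero, smul_neg, sub_neg_eq_add, eq_comm,
      neg_add_eq_zero] at h
    exact h
  have hpos := (S.g.pos x _ hv0).ne'
  refine h_curv X hX ?_ ?_
  · rw [LinearIndependent.pair_iff]
    intro s t hst
    have ht := congrArg (S.η x) hst
    rw [map_add, map_smul, map_smul, hv, S.η_ξ, map_zero, smul_zero, zero_add, smul_eq_mul,
      mul_one] at ht
    rw [ht, zero_smul, add_zero] at hst
    exact ⟨(smul_eq_zero.1 hst).resolve_right hv0, ht⟩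
  · rw [sectionalCurvature, curvature_ξ_ξ hS h_xi hX]
    simp only [Pi.neg_apply, EndField.act, hB, map_smul, map_neg, _root_.neg_apply,
      _root_.smul_apply, inner_ξ, hv, S.η_ξ, smul_eq_mul]
    rw [div_eq_iff (by simpa using hpos)]
    ring

end Cosymplectic

/-! ### `∇φ` when `h` is invertible on `ker η` -/

section Parallel

variable (hS : S.IsAlmostCosymplectic α)

include hS

omit [T2Space M] hS in
theorem nablaPhi_φ_right (hX : IsSmooth X) (hY : IsSmooth Y)
    (hηY : S.η x (Y x) = 0) (hηZ : S.η x (Z x) = 0) :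
    S.nablaPhi X (S.φ.act Y) Z x = S.nablaPhi X Y (S.φ.act Z) x := by
  have h := congrArg (fun v ↦ S.g.inner x v (Z x)) (covDerivEnd_φ_act (S := S) hX hY x)
  simp only [map_add, map_smul, _root_.add_apply, _root_.smul_apply, inner_φ, S.g.symm x (S.ξ x),
    inner_ξ, hηY, hηZ, zero_smul, smul_eq_mul, mul_zero, add_zero, ← sub_eq_add_neg] at h
  exact sub_eq_zero.1 h

theorem nablaPhi_cyclic_horizontal (hX : IsSmooth X) (hY : IsSmooth Y) (hZ : IsSmooth Z)
    (hηX : S.η x (X x) = 0) (hηY : S.η x (Y x) = 0) (hηZ : S.η x (Z x) = 0) :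
    S.nablaPhi X Y Z x + S.nablaPhi Y Z X x + S.nablaPhi Z X Y x = 0 := by
  rw [nablaPhi_cyclic hS hX hY hZ, wedgeOneTwo, hηX, hηY, hηZ]
  ring

/-- On `ker η`, the covariant derivative of `φ` behaves as on an almost Kaehler manifold. -/
theorem nablaPhi_φ_left (hX : IsSmooth X) (hY : IsSmooth Y) (hZ : IsSmooth Z)
    (hηX : S.η x (X x) = 0) (hηY : S.η x (Y x) = 0) (hηZ : S.η x (Z x) = 0) :
    S.nablaPhi (S.φ.act X) Y (S.φ.act Z) x = -S.nablaPhi X Y Z x := by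
  have hφX := S.smooth_act hX
  have hφY := S.smooth_act hY
  have hφZ := S.smooth_act hZ
  have hη : ∀ V : Field E M, S.η x (S.φ.act V x) = 0 := fun V ↦ S.η_φ x (V x)
  have hsq : ∀ {U V W}, S.η x (W x) = 0 →
      S.nablaPhi U V (S.φ.act (S.φ.act W)) x = -S.nablaPhi U V W x := fun {U V W} hW ↦ by
    simp only [nablaPhi, EndField.act, φ_sq, hW, zero_smul, add_zero, map_neg]
  -- combine the cyclic identity for `(X, Y, Z)` and for the triples with two arguments replaced by
  -- their images under `φ`
  have c1 := nablaPhi_cyclic_horizontal hS hX hY hZ hηX hηY hηZ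
  have c2 := nablaPhi_cyclic_horizontal hS hX hφY hφZ hηX (hη _) (hη _)
  have c3 := nablaPhi_cyclic_horizontal hS hφX hY hφZ (hη _) hηY (hη _)
  have c4 := nablaPhi_cyclic_horizontal hS hφX hφY hZ (hη _) (hη _) hηZ
  rw [nablaPhi_φ_right hX hY hηY (hη _), hsq hηZ, nablaPhi_φ_right hφY hZ hηZ hηX] at c2
  rw [nablaPhi_φ_right hY hZ hηZ (hη _), hsq hηX, nablaPhi_φ_right hφZ hX hηX hηY] at c3
  rw [nablaPhi_φ_right hφX hY hηY hηZ, nablaPhi_φ_right hZ hX hηX (hη _), hsq hηY] at c4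
  linarith

/-- If `h` is `η`-parallel, then `∇_X φ` anticommutes with `h` on `ker η`, as `φ` does. -/
theorem nablaPhi_hEnd (h_par : S.IsEtaParallel S.h) (hX : IsSmooth X) (hY : IsSmooth Y)
    (hZ : IsSmooth Z) (hηX : ∀ x, S.η x (X x) = 0) (hηY : ∀ x, S.η x (Y x) = 0)
    (hηZ : ∀ x, S.η x (Z x) = 0) (x : M) :
    S.nablaPhi X Y ((S.hEnd α).act Z) x + S.nablaPhi X ((S.hEnd α).act Y) Z x = 0 := by
  have hφY := S.smooth_act hY
  have hφZ := S.smooth_act hZ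
  have hhY : IsSmooth ((S.hEnd α).act Y) := smooth_hEnd hY
  have hη : ∀ (V : Field E M) x, S.η x (S.φ.act V x) = 0 := fun V x ↦ S.η_φ x (V x)
  have p1 := h_par X (S.φ.act Y) Z hX hφY hZ hηX (hη Y) hηZ x
  have p2 := h_par X Y (S.φ.act Z) hX hY hφZ hηX hηY (hη Z) x
  rw [covDerivEnd_h hS hX hφY] at p1
  rw [covDerivEnd_h hS hX hY] at p2
  have h1 : (S.hEnd α).act (S.φ.act Y) = -S.φ.act ((S.hEnd α).act Y) :=
    funext fun y ↦ hEnd_φ hS y (Y y)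
  simp only [covDerivEnd, Pi.sub_apply, map_sub, _root_.sub_apply, h1, map_neg,
    leviCivita_neg_right S.g hX (S.smooth_act hhY), Pi.neg_apply, _root_.neg_apply] at p1 p2
  simp only [nablaPhi, covDerivEnd, Pi.sub_apply, map_sub, _root_.sub_apply]
  simp only [EndField.act, inner_φ, hEnd_symm hS, hEnd_φ hS, map_neg] at *
  linarith

/-- If `h` is invertible on `ker η`, then `φ` is `η`-parallel: on `ker η`, the endomorphisms
`∇_X φ` both commute and anticommute with `h`. -/
theorem isEtaParallel_φ (h_par : S.IsEtaParallel S.h)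
    (hinj : ∀ x v, S.η x v = 0 → S.hEnd α x v = 0 → v = 0) : S.IsEtaParallel S.φ.act := by
  intro X Y Z hX hY hZ hηX hηY hηZ x
  -- it suffices to consider vectors of the form `h Z`
  suffices key : ∀ {Z}, IsSmooth Z → (∀ x, S.η x (Z x) = 0) →
      S.nablaPhi X Y ((S.hEnd α).act Z) x = 0 by
    have : FiniteDimensional ℝ (TangentSpace 𝓘(ℝ, E) x) := inferInstanceAs (FiniteDimensional ℝ E)
    let T : TangentSpace 𝓘(ℝ, E) x →ₗ[ℝ] TangentSpace 𝓘(ℝ, E) x :=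
      (S.hEnd α x + (S.η x).smulRight (S.ξ x)).toLinearMap
    have hT : ∀ v, T v = S.hEnd α x v + S.η x v • S.ξ x := fun v ↦ rfl
    have hηT : ∀ v, S.η x (T v) = S.η x v := fun v ↦ by
      rw [hT, map_add, η_hEnd, map_smul, S.η_ξ, smul_eq_mul, mul_one, zero_add]
    have hTinj : Function.Injective T := by
      rw [← LinearMap.ker_eq_bot, LinearMap.ker_eq_bot']
      intro v hv
      have h0 : S.η x v = 0 := by rw [← hηT, hv, map_zero]
      rw [hT, h0, zero_smul, add_zero] at hv
      exact hinj x v h0 hv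
    obtain ⟨w, hw⟩ := LinearMap.injective_iff_surjective.1 hTinj (Z x)
    have hηw : S.η x w = 0 := by rw [← hηT, hw, hηZ]
    rw [hT, hηw, zero_smul, add_zero] at hw
    obtain ⟨W, hW, rfl⟩ := exists_isSmooth_apply_eq x w
    have h := key (smooth_horizontal (S := S) hW) (η_horizontal W)
    rwa [nablaPhi, EndField.act, horizontal_apply, hηw, zero_smul, sub_zero, hw] at h
  intro Z hZ hηZ
  have hφX := S.smooth_act hX
  have hφZ := S.smooth_act hZ
  have hhY : IsSmooth ((S.hEnd α).act Y) := smooth_hEnd hY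
  have hhZ : IsSmooth ((S.hEnd α).act Z) := smooth_hEnd hZ
  have hη : ∀ (V : Field E M) x, S.η x (S.φ.act V x) = 0 := fun V x ↦ S.η_φ x (V x)
  have hηh : ∀ (V : Field E M) x, S.η x ((S.hEnd α).act V x) = 0 := fun V x ↦ S.η_hEnd x (V x)
  have e1 := nablaPhi_hEnd hS h_par hX hY hZ hηX hηY hηZ x
  have e2 := nablaPhi_hEnd hS h_par hφX hY hφZ (hη X) hηY (hη Z) x
  have e3 := nablaPhi_φ_left hS hX hY hhZ (hηX x) (hηY x) (hηh Z x)
  have e4 := nablaPhi_φ_left hS hX hhY hZ (hηX x) (hηh Y x) (hηZ x)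
  have e5 : S.nablaPhi (S.φ.act X) Y ((S.hEnd α).act (S.φ.act Z)) x =
      -S.nablaPhi (S.φ.act X) Y (S.φ.act ((S.hEnd α).act Z)) x := by
    simp only [nablaPhi, EndField.act, hEnd_φ hS, map_neg]
  linarith

/-- For `η`-parallel `φ`, the derivative `∇φ` is determined by `A = -∇ξ`. -/
theorem covDerivEnd_φ_eq (hp : S.IsEtaParallel S.φ.act) (hX : IsSmooth X) (hY : IsSmooth Y)
    (x : M) : covDerivEnd S.g S.φ.act X Y x =
      -(S.g.inner x (S.φ x (S.A α X x)) (Y x)) • S.ξ x + S.η x (Y x) • S.φ x (S.A α X x) := by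
  rw [covDerivEnd_eq_of_isEtaParallel hS S.smooth_act S.φ_ξ S.η_φ
    (fun Y hY ↦ funext (covDerivEnd_φ_ξ_left hS hY)) hp hX hY, A_eq hS hX]
  simp only [Pi.neg_apply, EndField.act, map_neg, _root_.neg_apply, inner_φ,
    S.g.symm x (S.nablaXi x (X x))]
  module

theorem covDerivEnd_hEnd_eq (h_par : S.IsEtaParallel S.h)
    (h_xi : ∀ Y : Field E M, IsSmooth Y → covDerivEnd S.g S.h S.ξ Y = 0)
    (hX : IsSmooth X) (hY : IsSmooth Y) (x : M) : covDerivEnd S.g (S.hEnd α).act X Y x =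
      -S.g.inner x (S.hEnd α x (Y x)) (S.nablaXi x (X x)) • S.ξ x
        - S.η x (Y x) • S.hEnd α x (S.nablaXi x (X x)) := by
  refine covDerivEnd_eq_of_isEtaParallel hS smooth_hEnd (hEnd_ξ hS) S.η_hEnd
    (fun Y hY ↦ ?_) (fun X Y Z hX hY hZ h1 h2 h3 x ↦ ?_) hX hY x
  · rw [← covDerivEnd_h hS S.smooth_ξ hY, h_xi Y hY]
  · rw [← covDerivEnd_h hS hX hY, h_par X Y Z hX hY hZ h1 h2 h3]

end Parallel

end AlmostContactMetric

section Det

open Filter Topology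

variable {E : Type*} [NormedAddCommGroup E] [NormedSpace ℝ E]
  {M : Type*} [TopologicalSpace M] [ChartedSpace E M]

/-! ### Derivatives of determinants -/

theorem dirDeriv_congr {X : Field E M} {f g : M → ℝ} {x : M} (h : f =ᶠ[𝓝 x] g) :
    dirDeriv X f x = dirDeriv X g x :=
  DFunLike.congr_fun h.mfderiv_eq (X x)

/-- Jacobi's formula for the derivative of the determinant. -/
theorem hasFDerivAt_det {ι : Type*} [Fintype ι] [DecidableEq ι] (A : ι → ι → ℝ) :
    ∃ D : (ι → ι → ℝ) →L[ℝ] ℝ, HasFDerivAt (fun B : ι → ι → ℝ ↦ (Matrix.of B).det) D A ∧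
      ∀ B, D B = ((Matrix.of A).adjugate * Matrix.of B).trace := by
  let m : ContinuousMultilinearMap ℝ (fun _ : ι ↦ ι → ℝ) ℝ :=
    ⟨(Matrix.detRowAlternating (R := ℝ) (n := ι)).toMultilinearMap,
      Continuous.matrix_det (A := fun B : ι → ι → ℝ ↦ Matrix.of B) continuous_id⟩
  refine ⟨_, m.hasFDerivAt A, fun B ↦ ?_⟩
  rw [ContinuousMultilinearMap.linearDeriv_apply, Matrix.trace_mul_comm, Matrix.trace]
  refine Finset.sum_congr rfl fun i _ ↦ ?_
  have h := Matrix.cramer_transpose_apply (Matrix.of A) (B i) i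
  rw [Matrix.cramer_eq_adjugate_mulVec, ← Matrix.adjugate_transpose] at h
  have h2 : m (Function.update A i (B i)) = ((Matrix.of A).updateRow i (B i)).det := rfl
  rw [h2, ← h, Matrix.diag_apply, Matrix.mul_apply]
  exact Finset.sum_congr rfl fun j _ ↦ mul_comm _ _

theorem dirDeriv_det {ι : Type*} [Fintype ι] [DecidableEq ι] {A : M → Matrix ι ι ℝ} {x : M}
    (h : ∀ i j, ContMDiffAt 𝓘(ℝ, E) 𝓘(ℝ, ℝ) ∞ (fun y ↦ A y i j) x) (X : Field E M) :
    dirDeriv X (fun y ↦ (A y).det) x =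
      ((A x).adjugate * Matrix.of fun i j ↦ dirDeriv X (fun y ↦ A y i j) x).trace := by
  obtain ⟨D, hD, hD'⟩ := hasFDerivAt_det (A x)
  let a : M → ι → ι → ℝ := fun y i j ↦ A y i j
  have hA : MDifferentiableAt 𝓘(ℝ, E) 𝓘(ℝ, ι → ι → ℝ) a x :=
    (contMDiffAt_pi_space.2 fun i ↦ contMDiffAt_pi_space.2 fun j ↦ h i j).mdifferentiableAt
      (by simp)
  have key : ∀ {f : (ι → ι → ℝ) → ℝ} {f' : (ι → ι → ℝ) →L[ℝ] ℝ}, HasFDerivAt f f' (a x) →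
      dirDeriv X (f ∘ a) x = f' (mvfderiv 𝓘(ℝ, E) a x (X x)) := fun {f f'} hf ↦ by
    rw [dirDeriv, mvfderiv_comp_apply x hf.differentiableAt.mdifferentiableAt hA]
    change mfderiv 𝓘(ℝ, ι → ι → ℝ) 𝓘(ℝ, ℝ) f (a x) _ = _
    rw [mfderiv_eq_fderiv, hf.fderiv]
    rfl
  refine (key hD).trans ((hD' _).trans ?_)
  congr 2
  ext i j
  exact (key (((ContinuousLinearMap.proj (R := ℝ) (φ := fun _ : ι ↦ ℝ) j).comp
    (ContinuousLinearMap.proj (R := ℝ) (φ := fun _ : ι ↦ ι → ℝ) i)).hasFDerivAt)).symm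

/-- The trace computation behind the constancy of a determinant: `G` is a Gram matrix, `A` the
matrix of an endomorphism, `P` that of its covariant derivative, and `Γ` the connection matrix. -/
theorem trace_inv_mul_gram {ι : Type*} [Fintype ι] [DecidableEq ι] {A G : Matrix ι ι ℝ}
    (P Γ : Matrix ι ι ℝ) (hA : IsUnit A.det) (hG : IsUnit G.det) :
    ((A.transpose * G)⁻¹ * ((P + A * Γ).transpose * G + A.transpose * G * Γ)).trace =
      (P * A⁻¹).trace + (G⁻¹ * (Γ.transpose * G + G * Γ)).trace := by
  have hA' : IsUnit A.transpose.det := by rwa [Matrix.det_transpose]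
  rw [Matrix.mul_inv_rev]
  have h1 : G⁻¹ * A.transpose⁻¹ * ((P + A * Γ).transpose * G + A.transpose * G * Γ) =
      G⁻¹ * (A.transpose⁻¹ * P.transpose) * G
        + G⁻¹ * (A.transpose⁻¹ * (Γ.transpose * A.transpose)) * G + Γ := by
    rw [Matrix.transpose_add, Matrix.transpose_mul, mul_add, add_mul, mul_add]
    congr 1
    · simp only [mul_assoc]
    · calc G⁻¹ * A.transpose⁻¹ * (A.transpose * G * Γ) =
          G⁻¹ * ((A.transpose⁻¹ * A.transpose) * (G * Γ)) := by simp only [mul_assoc]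
        _ = Γ := by
          rw [Matrix.nonsing_inv_mul _ hA', one_mul, ← mul_assoc, Matrix.nonsing_inv_mul _ hG,
            one_mul]
  have conj : ∀ B : Matrix ι ι ℝ, (G⁻¹ * B * G).trace = B.trace := fun B ↦ by
    rw [Matrix.trace_mul_cycle, Matrix.mul_nonsing_inv _ hG, one_mul]
  have h2 : (A.transpose⁻¹ * (Γ.transpose * A.transpose)).trace = Γ.trace := by
    rw [← mul_assoc, Matrix.trace_mul_cycle, Matrix.mul_nonsing_inv _ hA', one_mul,
      Matrix.trace_transpose]
  have h3 : (A.transpose⁻¹ * P.transpose).trace = (P * A⁻¹).trace := by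
    rw [← Matrix.transpose_nonsing_inv, ← Matrix.transpose_mul, Matrix.trace_transpose]
  rw [h1, Matrix.trace_add, Matrix.trace_add, conj, conj, h2, h3, mul_add, Matrix.trace_add,
    ← mul_assoc, ← mul_assoc, conj, Matrix.nonsing_inv_mul _ hG, one_mul, Matrix.trace_transpose]
  ring

/-- A function whose derivative vanishes wherever the function does not is constant, as soon as it
has a non-zero value. -/
theorem eq_of_mvfderiv_eq_zero [ConnectedSpace M] [IsManifold 𝓘(ℝ, E) ∞ M] {f : M → ℝ}
    (hf : ContMDiff 𝓘(ℝ, E) 𝓘(ℝ, ℝ) ∞ f) (h : ∀ x, f x ≠ 0 → mvfderiv 𝓘(ℝ, E) f x = 0) {p : M}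
    (hp : f p ≠ 0) (x : M) : f x = f p := by
  have hopen : IsOpen {x | f x = f p} := by
    rw [isOpen_iff_mem_nhds]
    intro y (hy : f y = f p)
    set c := extChartAt 𝓘(ℝ, E) y with hc
    have hcs : ContMDiffOn 𝓘(ℝ, E) 𝓘(ℝ, E) ∞ c.symm c.target := contMDiffOn_extChartAt_symm y
    have hF : ContMDiffOn 𝓘(ℝ, E) 𝓘(ℝ, ℝ) ∞ (f ∘ c.symm) c.target := hf.comp_contMDiffOn hcs
    have hto : IsOpen c.target := isOpen_extChartAt_target y
    let s := c.target ∩ (f ∘ c.symm) ⁻¹' {0}ᶜ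
    have hs : IsOpen s := hF.continuousOn.isOpen_inter_preimage hto isOpen_compl_singleton
    have hF' : DifferentiableOn ℝ (f ∘ c.symm) s :=
      (hF.contDiffOn.differentiableOn (by simp)).mono Set.inter_subset_left
    have hd : s.EqOn (fderiv ℝ (f ∘ c.symm)) 0 := by
      intro z hz
      have h1 : MDifferentiableAt 𝓘(ℝ, E) 𝓘(ℝ, E) c.symm z :=
        (hcs.contMDiffAt (hto.mem_nhds hz.1)).mdifferentiableAt (by simp)
      have h2 : MDifferentiableAt 𝓘(ℝ, E) 𝓘(ℝ, ℝ) f (c.symm z) :=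
        (hf _).mdifferentiableAt (by simp)
      have h3 : mfderiv 𝓘(ℝ, E) 𝓘(ℝ, ℝ) f (c.symm z) = 0 := h _ hz.2
      rw [← mfderiv_eq_fderiv, mfderiv_comp z h2 h1, h3]
      exact ContinuousLinearMap.zero_comp _
    have ho := hs.isOpen_inter_preimage_of_fderiv_eq_zero hF' hd {f p}
    have hcy : c.symm (c y) = y := extChartAt_to_inv y
    have hmem : c y ∈ s ∩ (f ∘ c.symm) ⁻¹' {f p} :=
      ⟨⟨mem_extChartAt_target y, by simpa [hcy, hy] using hp⟩, by simp [hcy, hy]⟩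
    filter_upwards [(continuousAt_extChartAt y).preimage_mem_nhds (ho.mem_nhds hmem),
      extChartAt_source_mem_nhds (I := 𝓘(ℝ, E)) y] with z hz hzs
    have h1 : f (c.symm (c z)) = f p := hz.2
    rwa [c.left_inv hzs] at h1
  have hclosed : IsClosed {x | f x = f p} := isClosed_eq hf.continuous continuous_const
  have huniv := IsClopen.eq_univ ⟨hclosed, hopen⟩ ⟨p, rfl⟩
  exact (Set.eq_univ_iff_forall.1 huniv) x

variable [IsManifold 𝓘(ℝ, E) ∞ M] [FiniteDimensional ℝ E] [T2Space M]

section Gram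

omit [FiniteDimensional ℝ E] [T2Space M]

/-- The matrix of the bilinear form `g(B ·, ·)`. -/
theorem inner_toMatrix_left (g : Metric E M) {x : M} {ι : Type*} [Fintype ι] [DecidableEq ι]
    (b : Module.Basis ι ℝ (TangentSpace 𝓘(ℝ, E) x))
    (B : TangentSpace 𝓘(ℝ, E) x →ₗ[ℝ] TangentSpace 𝓘(ℝ, E) x) (i : ι)
    (w : TangentSpace 𝓘(ℝ, E) x) :
    g.inner x (B (b i)) w = ∑ k, LinearMap.toMatrix b b B k i * g.inner x (b k) w := by
  conv_lhs => rw [← b.sum_repr (B (b i))]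
  rw [map_sum, _root_.sum_apply]
  exact Finset.sum_congr rfl fun k _ ↦ by
    rw [map_smul, _root_.smul_apply, LinearMap.toMatrix_apply, smul_eq_mul]

/-- The determinant of an endomorphism as a quotient of determinants of scalar products. -/
theorem det_mul_det_gram (g : Metric E M) (T : EndField E M)
    {ι : Type*} [Fintype ι] [DecidableEq ι] {y : M} {e : ι → Field E M}
    (h : ∃ b : Module.Basis ι ℝ (TangentSpace 𝓘(ℝ, E) y), ∀ i, b i = e i y) :
    LinearMap.det (T y).toLinearMap * (Matrix.of fun i j ↦ g.inner y (e i y) (e j y)).det =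
      (Matrix.of fun i j ↦ g.inner y (T.act (e i) y) (e j y)).det := by
  obtain ⟨b, hb⟩ := h
  rw [← LinearMap.det_toMatrix b, ← Matrix.det_transpose, ← Matrix.det_mul]
  congr 1
  ext i j
  have := inner_toMatrix_left g b (T y).toLinearMap i (e j y)
  rw [hb] at this
  refine Eq.trans ?_ this.symm
  simp [Matrix.mul_apply, hb]

end Gram

theorem contMDiff_det (g : Metric E M) {T : EndField E M}
    (hT : ∀ X, IsSmooth X → IsSmooth (T.act X)) :
    ContMDiff 𝓘(ℝ, E) 𝓘(ℝ, ℝ) ∞ (fun y ↦ LinearMap.det (T y).toLinearMap) := by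
  intro x
  obtain ⟨e, he, heb⟩ := exists_frame (M := M) x (Module.finBasis ℝ E)
  have h0 : (Matrix.of fun i j ↦ g.inner x (e i x) (e j x)).det ≠ 0 := by
    obtain ⟨b, hb⟩ := heb.self_of_nhds
    simpa only [hb] using det_gram_ne_zero g b
  have h1 : ContMDiffAt 𝓘(ℝ, E) 𝓘(ℝ, ℝ) ∞
      (fun y ↦ (Matrix.of fun i j ↦ g.inner y (e i y) (e j y)).det) x :=
    contMDiffAt_det fun i j ↦ (IsSmooth.inner g (he i) (he j)) x
  have h2 : ContMDiffAt 𝓘(ℝ, E) 𝓘(ℝ, ℝ) ∞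
      (fun y ↦ (Matrix.of fun i j ↦ g.inner y (T.act (e i) y) (e j y)).det) x :=
    contMDiffAt_det fun i j ↦ (IsSmooth.inner g (hT _ (he i)) (he j)) x
  refine (h2.div₀ h1 h0).congr_of_eventuallyEq ?_
  filter_upwards [heb, h1.continuousAt.eventually_ne h0] with y hy hy0
  exact eq_div_of_mul_eq hy0 (det_mul_det_gram g T hy)

/-- If `∇_X T = P` at `x` with `tr (P T⁻¹) = 0`, then the derivative of `det T` along `X` vanishes
at `x`. -/
theorem dirDeriv_det_eq_zero (g : Metric E M) {T : EndField E M}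
    (hT : ∀ X, IsSmooth X → IsSmooth (T.act X)) {X : Field E M} (hX : IsSmooth X) {x : M}
    (hx : LinearMap.det (T x).toLinearMap ≠ 0)
    {P Q : TangentSpace 𝓘(ℝ, E) x →ₗ[ℝ] TangentSpace 𝓘(ℝ, E) x}
    (hP : ∀ Y, IsSmooth Y → covDerivEnd g T.act X Y x = P (Y x))
    (hQ : (T x).toLinearMap ∘ₗ Q = LinearMap.id) (hPQ : LinearMap.trace ℝ _ (P ∘ₗ Q) = 0) :
    dirDeriv X (fun y ↦ LinearMap.det (T y).toLinearMap) x = 0 := by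
  obtain ⟨e, he, heb⟩ := exists_frame (M := M) x (Module.finBasis ℝ E)
  obtain ⟨b, hb⟩ := heb.self_of_nhds
  set f : M → ℝ := fun y ↦ LinearMap.det (T y).toLinearMap with hf
  let G : M → Matrix _ _ ℝ := fun y ↦ .of fun i j ↦ g.inner y (e i y) (e j y)
  let B : M → Matrix _ _ ℝ := fun y ↦ .of fun i j ↦ g.inner y (T.act (e i) y) (e j y)
  have hG : ∀ i j, ContMDiffAt 𝓘(ℝ, E) 𝓘(ℝ, ℝ) ∞ (fun y ↦ G y i j) x := fun i j ↦
    (IsSmooth.inner g (he i) (he j)) x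
  have hB : ∀ i j, ContMDiffAt 𝓘(ℝ, E) 𝓘(ℝ, ℝ) ∞ (fun y ↦ B y i j) x := fun i j ↦
    (IsSmooth.inner g (hT _ (he i)) (he j)) x
  have hG0 : (G x).det ≠ 0 := by simpa only [hb] using det_gram_ne_zero g b
  have hfG : ∀ᶠ y in 𝓝 x, f y * (G y).det = (B y).det := by
    filter_upwards [heb] with y hy using det_mul_det_gram g T hy
  let Γ' : TangentSpace 𝓘(ℝ, E) x →ₗ[ℝ] TangentSpace 𝓘(ℝ, E) x :=
    b.constr ℝ fun i ↦ leviCivita g X (e i) x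
  have hΓ' : ∀ i, Γ' (b i) = leviCivita g X (e i) x := fun i ↦ b.constr_basis ..
  -- `Γ` is the matrix of `e i ↦ ∇_X (e i)`, so that the Gram matrix `G` has derivative
  -- `Γᵀ G + G Γ`, and `B = Aᵀ G` has derivative `(p + A Γ)ᵀ G + Aᵀ G Γ`
  let A := LinearMap.toMatrix b b (T x).toLinearMap
  let p := LinearMap.toMatrix b b P
  let Γ := LinearMap.toMatrix b b Γ'
  have hBA : B x = A.transpose * G x := by
    ext i j
    have := inner_toMatrix_left g b (T x).toLinearMap i (e j x)
    rw [hb] at this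
    refine Eq.trans this ?_
    simp [Matrix.mul_apply, hb, A, G]
  have hdG : (Matrix.of fun i j ↦ dirDeriv X (fun y ↦ G y i j) x) =
      Γ.transpose * G x + G x * Γ := by
    ext i j
    have h1 : dirDeriv X (fun y ↦ G y i j) x = _ := dirDeriv_inner g hX (he i) (he j) x
    rw [Matrix.of_apply, h1, g.symm x (e i x), ← hΓ', ← hΓ', inner_toMatrix_left,
      inner_toMatrix_left]
    simp [Matrix.mul_apply, hb, Γ, G, mul_comm, g.symm x (e i x)]
  have hdB : (Matrix.of fun i j ↦ dirDeriv X (fun y ↦ B y i j) x) =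
      (p + A * Γ).transpose * G x + A.transpose * G x * Γ := by
    ext i j
    have h1 : dirDeriv X (fun y ↦ B y i j) x = _ := dirDeriv_inner g hX (hT _ (he i)) (he j) x
    have h2 : leviCivita g X (T.act (e i)) x = (P + (T x).toLinearMap ∘ₗ Γ') (b i) := by
      have := hP _ (he i)
      rw [covDerivEnd, Pi.sub_apply, sub_eq_iff_eq_add] at this
      rw [this, LinearMap.add_apply, LinearMap.comp_apply, hΓ', hb]
      rfl
    rw [Matrix.of_apply, h1, h2, g.symm x (T.act (e i) x), ← hΓ', inner_toMatrix_left,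
      inner_toMatrix_left, ← hBA, map_add, LinearMap.toMatrix_comp b b b]
    have h3 := fun k ↦ g.symm x (e k x) (T.act (e i) x)
    simp only [Matrix.add_apply, Matrix.mul_apply, Matrix.transpose_apply, hb, h3, Γ, G, B, p, A,
      mul_comm (LinearMap.toMatrix b b Γ' _ _), Matrix.of_apply]
  have hA : A.det = f x := LinearMap.det_toMatrix b _
  have hAQ : A⁻¹ = LinearMap.toMatrix b b Q := by
    refine Matrix.inv_eq_right_inv ?_
    rw [← LinearMap.toMatrix_comp b b b, hQ, LinearMap.toMatrix_id]
  have hadj : ∀ C D : Matrix (Fin (Module.finrank ℝ E)) (Fin (Module.finrank ℝ E)) ℝ,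
      C.det ≠ 0 → (C.adjugate * D).trace = C.det * (C⁻¹ * D).trace := fun C D hC ↦ by
    rw [Matrix.inv_def, Ring.inverse_eq_inv', Matrix.smul_mul, Matrix.trace_smul, smul_eq_mul,
      mul_inv_cancel_left₀ hC]
  have hB0 : (B x).det ≠ 0 := by
    rw [← hfG.self_of_nhds]
    exact mul_ne_zero hx hG0
  have key := trace_inv_mul_gram (A := A) (G := G x) p Γ (by rw [hA]; exact hx.isUnit) hG0.isUnit
  have hpQ : (p * A⁻¹).trace = 0 := by
    rw [hAQ, ← LinearMap.toMatrix_comp b b b, ← LinearMap.trace_eq_matrix_trace, hPQ]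
  rw [← hdG, ← hdB, hBA.symm, hpQ, zero_add] at key
  have hd1 := dirDeriv_det hG X
  have hd2 := dirDeriv_det hB X
  rw [hadj _ _ hG0] at hd1
  rw [hadj _ _ hB0, key] at hd2
  have hprod : dirDeriv X (fun y ↦ f y * (G y).det) x =
      f x * dirDeriv X (fun y ↦ (G y).det) x + (G x).det * dirDeriv X f x := by
    rw [dirDeriv, mvfderiv_fun_mul ((contMDiff_det g hT x).mdifferentiableAt (by simp))
      ((contMDiffAt_det hG).mdifferentiableAt (by simp))]
    rfl
  have hcongr : dirDeriv X (fun y ↦ f y * (G y).det) x = dirDeriv X (fun y ↦ (B y).det) x := by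
    exact dirDeriv_congr hfG
  rw [hcongr, hd2, hd1, ← hfG.self_of_nhds] at hprod
  have : (G x).det * dirDeriv X f x = 0 := by linarith
  exact (mul_eq_zero.1 this).resolve_left hG0

end Det

namespace AlmostContactMetric

section Injective

variable {E : Type*} [NormedAddCommGroup E] [NormedSpace ℝ E] [FiniteDimensional ℝ E]
  {M : Type*} [TopologicalSpace M] [ChartedSpace E M] [IsManifold 𝓘(ℝ, E) ∞ M] [T2Space M]
  {S : AlmostContactMetric E M} {α : ℝ}

/-! ### Invertibility of `h` on `ker η` -/

/-- The tensor `h + η ⊗ ξ`, which extends `h` on `ker η` by the identity on `ξ`. -/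
noncomputable def hXi (S : AlmostContactMetric E M) (α : ℝ) : EndField E M :=
  fun x ↦ S.hEnd α x + (S.η x).smulRight (S.ξ x)

omit [T2Space M] in
theorem hXi_apply (x : M) (v : TangentSpace 𝓘(ℝ, E) x) :
    S.hXi α x v = S.hEnd α x v + S.η x v • S.ξ x := rfl

omit [T2Space M] in
theorem hXi_act (X : Field E M) :
    (S.hXi α).act X = (S.hEnd α).act X + (fun x ↦ S.η x (X x)) • S.ξ := rfl

theorem smooth_hXi {X : Field E M} (hX : IsSmooth X) : IsSmooth ((S.hXi α).act X) :=
  (smooth_hEnd hX).add (S.smooth_ξ.smul (hX.form_apply S.smooth_η))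

omit [T2Space M] in
theorem η_hXi (x : M) (v : TangentSpace 𝓘(ℝ, E) x) : S.η x (S.hXi α x v) = S.η x v := by
  rw [hXi_apply, map_add, η_hEnd, map_smul, S.η_ξ, smul_eq_mul, mul_one, zero_add]

variable (hS : S.IsAlmostCosymplectic α)

include hS

theorem hXi_ξ (x : M) : S.hXi α x (S.ξ x) = S.ξ x := by
  rw [hXi_apply, hEnd_ξ hS, S.η_ξ, one_smul, zero_add]

/-- The covariant derivative of `h + η ⊗ ξ` is `g(u, ·) ξ + η ⊗ u` for a vector `u` orthogonal to
`ξ`. -/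
theorem covDerivEnd_hXi (h_par : S.IsEtaParallel S.h)
    (h_xi : ∀ Y : Field E M, IsSmooth Y → covDerivEnd S.g S.h S.ξ Y = 0)
    {X Y : Field E M} (hX : IsSmooth X) (hY : IsSmooth Y) (x : M) :
    covDerivEnd S.g (S.hXi α).act X Y x =
      S.g.inner x (S.nablaXi x (X x) - S.hEnd α x (S.nablaXi x (X x))) (Y x) • S.ξ x
        + S.η x (Y x) • (S.nablaXi x (X x) - S.hEnd α x (S.nablaXi x (X x))) := by
  have hη := hY.form_apply S.smooth_η
  have h := covDerivEnd_hEnd_eq hS h_par h_xi hX hY x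
  have hd := dirDeriv_η (S := S) hX hY x
  rw [covDerivEnd, Pi.sub_apply] at h
  rw [covDerivEnd, Pi.sub_apply, hXi_act, hXi_act, leviCivita_add_right S.g hX (smooth_hEnd hY)
    (S.smooth_ξ.smul hη), leviCivita_smul_right S.g hη hX S.smooth_ξ, leviCivita_ξ hX]
  simp only [Pi.add_apply, Pi.smul_apply', hd, EndField.act] at h ⊢
  rw [sub_eq_iff_eq_add] at h
  rw [h, map_sub, _root_.sub_apply, hEnd_symm hS, S.g.symm x (Y x) (S.nablaXi x (X x)),
    S.g.symm x (Y x) (S.hEnd α x _)]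
  module

/-- As `det (h + η ⊗ ξ)` is constant, `h` is invertible on `ker η` everywhere if it is so at one
point. -/
theorem hEnd_injective [ConnectedSpace M] (h_par : S.IsEtaParallel S.h)
    (h_xi : ∀ Y : Field E M, IsSmooth Y → covDerivEnd S.g S.h S.ξ Y = 0)
    (h_curv : ∃ p : M, S.XiSectionalCurvatureNeAt (-α ^ 2) p) (x : M)
    (v : TangentSpace 𝓘(ℝ, E) x) (hηv : S.η x v = 0) (hv : S.hEnd α x v = 0) : v = 0 := by
  obtain ⟨p, hp⟩ := h_curv
  have hfin : ∀ y : M, FiniteDimensional ℝ (TangentSpace 𝓘(ℝ, E) y) := fun y ↦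
    inferInstanceAs (FiniteDimensional ℝ E)
  let f : M → ℝ := fun y ↦ LinearMap.det (S.hXi α y).toLinearMap
  have hfp : f p ≠ 0 := by
    refine IsUnit.ne_zero (LinearMap.isUnit_det _ ((LinearMap.isUnit_iff_ker_eq_bot _).2 ?_))
    rw [LinearMap.ker_eq_bot']
    intro w (hw : S.hXi α p w = 0)
    have h0 : S.η p w = 0 := by rw [← η_hXi (α := α), hw, map_zero]
    rw [hXi_apply, h0, zero_smul, add_zero] at hw
    exact eq_zero_of_hEnd_eq_zero hS h_xi hp h0 hw
  have hf : ContMDiff 𝓘(ℝ, E) 𝓘(ℝ, ℝ) ∞ f := contMDiff_det S.g fun X hX ↦ smooth_hXi hX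
  have hconst : f x = f p := by
    refine eq_of_mvfderiv_eq_zero hf (fun y hy ↦ ContinuousLinearMap.ext fun w ↦ ?_) hfp x
    obtain ⟨X, hX, rfl⟩ := exists_isSmooth_apply_eq y w
    set u := S.nablaXi y (X y) - S.hEnd α y (S.nablaXi y (X y)) with hu
    have hηu : S.η y u = 0 := by rw [hu, map_sub, η_nablaXi, η_hEnd, sub_zero]
    let Q := (LinearMap.equivOfDetNeZero _ hy).symm.toLinearMap
    have hQ : ∀ w, S.hXi α y (Q w) = w := (LinearMap.equivOfDetNeZero _ hy).apply_symm_apply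
    have hQξ : Q (S.ξ y) = S.ξ y := by
      conv_lhs => rw [← hXi_ξ hS]
      exact (LinearMap.equivOfDetNeZero _ hy).symm_apply_apply _
    refine dirDeriv_det_eq_zero S.g (fun X hX ↦ smooth_hXi hX) hX hy
      (P := (S.g.inner y u).toLinearMap.smulRight (S.ξ y) + (S.η y).toLinearMap.smulRight u)
      (Q := Q) (fun Y hY ↦ covDerivEnd_hXi hS h_par h_xi hX hY y) (LinearMap.ext hQ) ?_
    have h1 : ((S.g.inner y u).toLinearMap.smulRight (S.ξ y)
        + (S.η y).toLinearMap.smulRight u) ∘ₗ Q =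
        ((S.g.inner y u).toLinearMap ∘ₗ Q).smulRight (S.ξ y)
          + ((S.η y).toLinearMap ∘ₗ Q).smulRight u := rfl
    rw [h1, map_add, LinearMap.trace_smulRight, LinearMap.trace_smulRight]
    -- the trace is `g(u, T⁻¹ ξ) + η (T⁻¹ u)`, with `T⁻¹ ξ = ξ` and `η ∘ T⁻¹ = η`
    have h2 : S.g.inner y u (S.ξ y) = 0 := by rw [inner_ξ, hηu]
    have h3 : S.η y (Q u) = 0 := by rw [← η_hXi (α := α), hQ, hηu]
    simp [hQξ, h2, h3]
  have hinj : Function.Injective (S.hXi α x) :=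
    (LinearMap.equivOfDetNeZero _ (hconst.trans_ne hfp)).injective
  refine hinj ?_
  rw [hXi_apply, hv, hηv, zero_smul, add_zero, map_zero]

end Injective

end AlmostContactMetric

section Bracket

open Filter Topology

variable {E : Type*} [NormedAddCommGroup E] [NormedSpace ℝ E] [FiniteDimensional ℝ E]
  {M : Type*} [TopologicalSpace M] [ChartedSpace E M] [IsManifold 𝓘(ℝ, E) ∞ M] [T2Space M]

/-! ### The Lie bracket as a commutator -/

/-- The Lie bracket acts on functions as a commutator. This follows from the Jacobi identity for
`X`, `Y` and `f Z` with `Z` not vanishing at the given point. -/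
theorem dirDeriv_bracket {X Y : Field E M} (hX : IsSmooth X) (hY : IsSmooth Y) {f : M → ℝ}
    (hf : ContMDiff 𝓘(ℝ, E) 𝓘(ℝ, ℝ) ∞ f) (x : M) :
    dirDeriv (bracket X Y) f x = dirDeriv X (dirDeriv Y f) x - dirDeriv Y (dirDeriv X f) x := by
  have : CompleteSpace E := FiniteDimensional.complete ℝ E
  have : IsManifold 𝓘(ℝ, E) (minSmoothness ℝ 3) M := by
    rw [minSmoothness_of_isRCLikeNormedField]
    infer_instance
  have h2 : minSmoothness ℝ 2 ≤ ∞ := by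
    rw [minSmoothness_of_isRCLikeNormedField]
    exact ENat.LEInfty.out
  by_cases hE : Subsingleton (TangentSpace 𝓘(ℝ, E) x)
  · have h0 : ∀ v : TangentSpace 𝓘(ℝ, E) x, v = 0 := fun v ↦ Subsingleton.elim v 0
    simp only [dirDeriv, h0 (X x), h0 (Y x), h0 (bracket X Y x), map_zero, sub_zero]
  rw [not_subsingleton_iff_nontrivial] at hE
  obtain ⟨v, hv⟩ := exists_ne (0 : TangentSpace 𝓘(ℝ, E) x)
  obtain ⟨Z, hZ, hZx⟩ := exists_isSmooth_apply_eq x v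
  have leib : ∀ {U W : Field E M} {k : M → ℝ}, ContMDiff 𝓘(ℝ, E) 𝓘(ℝ, ℝ) ∞ k → IsSmooth W →
      bracket U (k • W) = dirDeriv U k • W + k • bracket U W := fun {U W k} hk hW ↦ funext fun y ↦
    VectorField.mlieBracket_smul_right ((hk y).mdifferentiableAt (by simp)) (hW.mdifferentiableAt y)
  have badd : ∀ {U V W : Field E M}, IsSmooth V → IsSmooth W →
      bracket U (V + W) = bracket U V + bracket U W := fun {U V W} hV hW ↦ funext fun y ↦
    VectorField.mlieBracket_add_right (hV.mdifferentiableAt y) (hW.mdifferentiableAt y)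
  have jac : ∀ {W : Field E M}, IsSmooth W →
      bracket X (bracket Y W) = bracket (bracket X Y) W + bracket Y (bracket X W) := fun {W} hW ↦
    VectorField.leibniz_identity_mlieBracket (hX.of_le h2) (hY.of_le h2) (hW.of_le h2)
  have hYf := contMDiff_dirDeriv hf hY
  have hXf := contMDiff_dirDeriv hf hX
  have h1 := congrFun (jac (hZ.smul hf)) x
  rw [leib hf hZ, leib hf hZ, leib hf hZ, badd (hZ.smul hYf) ((hY.bracket hZ).smul hf),
    badd (hZ.smul hXf) ((hX.bracket hZ).smul hf), leib hYf hZ, leib hXf hZ, leib hf (hY.bracket hZ),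
    leib hf (hX.bracket hZ), jac hZ] at h1
  simp only [Pi.add_apply, Pi.smul_apply'] at h1
  have h2 : (dirDeriv (bracket X Y) f x - (dirDeriv X (dirDeriv Y f) x
      - dirDeriv Y (dirDeriv X f) x)) • Z x = 0 := by
    rw [← sub_eq_zero] at h1
    rw [← neg_eq_zero, ← h1]
    module
  exact sub_eq_zero.1 ((smul_eq_zero.1 h2).resolve_right (hZx ▸ hv))

/-- Tangent vectors are separated by the derivatives of smooth functions. -/
theorem eq_of_mvfderiv_eq {x : M} {v w : TangentSpace 𝓘(ℝ, E) x}
    (h : ∀ f : M → ℝ, ContMDiff 𝓘(ℝ, E) 𝓘(ℝ, ℝ) ∞ f →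
      mvfderiv 𝓘(ℝ, E) f x v = mvfderiv 𝓘(ℝ, E) f x w) : v = w := by
  set c := extChartAt 𝓘(ℝ, E) x
  obtain ⟨b⟩ : Nonempty (SmoothBumpFunction 𝓘(ℝ, E) x) := inferInstance
  have hcs : MDifferentiableAt 𝓘(ℝ, E) 𝓘(ℝ, E) c x :=
    mdifferentiableAt_extChartAt (mem_chart_source E x)
  have key : mfderiv 𝓘(ℝ, E) 𝓘(ℝ, E) c x v = mfderiv 𝓘(ℝ, E) 𝓘(ℝ, E) c x w := by
    refine (SeparatingDual.eq_iff_forall_dual_eq (R := ℝ) (V := E)).2 fun l ↦ ?_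
    have hl : MDifferentiableAt 𝓘(ℝ, E) 𝓘(ℝ, ℝ) l (c x) := l.differentiableAt.mdifferentiableAt
    have hsm : ContMDiff 𝓘(ℝ, E) 𝓘(ℝ, ℝ) ∞ (fun y ↦ b y • l (c y)) := by
      refine b.contMDiff_smul (g := fun y ↦ l (c y)) ?_
      exact l.contDiff.contMDiff.comp_contMDiffOn contMDiffOn_extChartAt
    have heq : (fun y ↦ b y • l (c y)) =ᶠ[𝓝 x] l ∘ c := by
      filter_upwards [b.eventuallyEq_one] with y hy
      rw [hy]
      simp
    have hd : ∀ u : TangentSpace 𝓘(ℝ, E) x, mvfderiv 𝓘(ℝ, E) (fun y ↦ b y • l (c y)) x u =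
        l (mfderiv 𝓘(ℝ, E) 𝓘(ℝ, E) c x u) := fun u ↦ by
      have h1 : mvfderiv 𝓘(ℝ, E) (fun y ↦ b y • l (c y)) x u = mvfderiv 𝓘(ℝ, E) (l ∘ c) x u :=
        DFunLike.congr_fun heq.mfderiv_eq u
      rw [h1, mvfderiv_comp_apply x hl hcs]
      change mfderiv 𝓘(ℝ, E) 𝓘(ℝ, ℝ) l (c x) _ = _
      rw [mfderiv_eq_fderiv, l.fderiv]
      rfl
    have := h _ hsm
    rwa [hd, hd] at this
  exact (isInvertible_mfderiv_extChartAt (mem_extChartAt_source x)).injective key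

end Bracket

section Related

open Filter Topology

variable {F : Type*} [NormedAddCommGroup F] [NormedSpace ℝ F] [FiniteDimensional ℝ F]
  {N : Type*} [TopologicalSpace N] [ChartedSpace F N] [IsManifold 𝓘(ℝ, F) ∞ N] [T2Space N]
  {E : Type*} [NormedAddCommGroup E] [NormedSpace ℝ E] [FiniteDimensional ℝ E]
  {M : Type*} [TopologicalSpace M] [ChartedSpace E M] [IsManifold 𝓘(ℝ, E) ∞ M] [T2Space M]

/-! ### Related vector fields -/

/-- Vector fields `X` on `N` and `X'` on `M` are `ι`-related near `q` if `dι X = X' ∘ ι` on a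
neighbourhood of `q`. -/
def RelatedAt (ι : N → M) (q : N) (X : Field F N) (X' : Field E M) : Prop :=
  ∀ᶠ q' in 𝓝 q, mfderiv 𝓘(ℝ, F) 𝓘(ℝ, E) ι q' (X q') = X' (ι q')

variable {ι : N → M} {q : N} {X Y : Field F N} {X' Y' : Field E M}

section Pointwise

omit [FiniteDimensional ℝ F] [IsManifold 𝓘(ℝ, F) ∞ N] [T2Space N] [FiniteDimensional ℝ E]
  [IsManifold 𝓘(ℝ, E) ∞ M] [T2Space M]

theorem RelatedAt.apply_eq (h : RelatedAt ι q X X') :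
    mfderiv 𝓘(ℝ, F) 𝓘(ℝ, E) ι q (X q) = X' (ι q) :=
  h.self_of_nhds

theorem dirDeriv_comp (hι : ContMDiff 𝓘(ℝ, F) 𝓘(ℝ, E) ∞ ι) {f : M → ℝ}
    (hf : ContMDiff 𝓘(ℝ, E) 𝓘(ℝ, ℝ) ∞ f)
    (h : mfderiv 𝓘(ℝ, F) 𝓘(ℝ, E) ι q (X q) = X' (ι q)) :
    dirDeriv X (f ∘ ι) q = dirDeriv X' f (ι q) := by
  rw [dirDeriv, mvfderiv_comp_apply q ((hf _).mdifferentiableAt (by simp))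
    ((hι q).mdifferentiableAt (by simp)), h]
  rfl

end Pointwise

/-- Brackets of related vector fields are related. -/
theorem RelatedAt.bracket_apply (hι : ContMDiff 𝓘(ℝ, F) 𝓘(ℝ, E) ∞ ι) (hX : IsSmooth X)
    (hY : IsSmooth Y) (hX' : IsSmooth X') (hY' : IsSmooth Y') (h : RelatedAt ι q X X')
    (h' : RelatedAt ι q Y Y') :
    mfderiv 𝓘(ℝ, F) 𝓘(ℝ, E) ι q (bracket X Y q) = bracket X' Y' (ι q) := by
  refine eq_of_mvfderiv_eq fun f hf ↦ ?_
  have h1 : dirDeriv X (dirDeriv Y (f ∘ ι)) q = dirDeriv X' (dirDeriv Y' f) (ι q) := by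
    rw [← dirDeriv_comp hι (contMDiff_dirDeriv hf hY') h.apply_eq]
    exact dirDeriv_congr (h'.mono fun q' hq' ↦ dirDeriv_comp hι hf hq')
  have h2 : dirDeriv Y (dirDeriv X (f ∘ ι)) q = dirDeriv Y' (dirDeriv X' f) (ι q) := by
    rw [← dirDeriv_comp hι (contMDiff_dirDeriv hf hX') h'.apply_eq]
    exact dirDeriv_congr (h.mono fun q' hq' ↦ dirDeriv_comp hι hf hq')
  have h3 := dirDeriv_bracket hX hY (hf.comp hι) q
  rw [h1, h2, ← dirDeriv_bracket hX' hY' hf] at h3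
  rw [← mvfderiv_comp_apply q ((hf _).mdifferentiableAt (by simp))
    ((hι q).mdifferentiableAt (by simp))]
  exact h3

/-! ### Extension of vector fields along an immersion -/

omit [FiniteDimensional ℝ F] in
/-- The inverse function theorem, in the form of a smooth local left inverse. -/
theorem exists_local_leftInverse [CompleteSpace F] {g : F → F} {a : F}
    (hg : ∀ᶠ z in 𝓝 a, ContDiffAt ℝ ∞ g z)
    (hg' : HasFDerivAt g (ContinuousLinearMap.id ℝ F) a) :
    ∃ s : F → F, (∀ᶠ w in 𝓝 (g a), ContDiffAt ℝ ∞ s w) ∧ ∀ᶠ z in 𝓝 a, s (g z) = z := by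
  have hg0 : HasFDerivAt g ((ContinuousLinearEquiv.refl ℝ F : F ≃L[ℝ] F) : F →L[ℝ] F) a := hg'
  have hga := hg.self_of_nhds
  let P := hga.toOpenPartialHomeomorph g hg0 (by simp)
  have haP : a ∈ P.source := hga.mem_toOpenPartialHomeomorph_source hg0 (by simp)
  have hgaP : g a ∈ P.target := hga.image_mem_toOpenPartialHomeomorph_target hg0 (by simp)
  refine ⟨P.symm, ?_, P.eventually_left_inverse haP⟩
  have hinv : ∀ᶠ z in 𝓝 a, ∃ e : F ≃L[ℝ] F, (e : F →L[ℝ] F) = fderiv ℝ g z := by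
    have hc : ContinuousAt (fderiv ℝ g) a := (hga.fderiv_right (m := 0) (by simp)).continuousAt
    rw [ContinuousAt, hg0.fderiv] at hc
    exact hc.eventually (ContinuousLinearEquiv.nhds _)
  have hcont : Tendsto P.symm (𝓝 (g a)) (𝓝 a) := by
    have := P.continuousAt_symm hgaP
    rwa [ContinuousAt, show P.symm (g a) = a from P.left_inv haP] at this
  filter_upwards [hcont.eventually (hg.and hinv), P.open_target.mem_nhds hgaP]
    with w ⟨hw1, e, he⟩ hw2
  refine P.contDiffAt_symm (f₀' := e) hw2 ?_ hw1
  rw [he]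
  exact (hw1.differentiableAt (by simp)).hasFDerivAt

omit [T2Space N] [T2Space M] in
/-- An immersion has smooth local left inverses. -/
theorem exists_local_retraction (hι : ContMDiff 𝓘(ℝ, F) 𝓘(ℝ, E) ∞ ι)
    (hinj : Function.Injective (mfderiv 𝓘(ℝ, F) 𝓘(ℝ, E) ι q)) :
    ∃ r : M → N, (∀ᶠ y in 𝓝 (ι q), ContMDiffAt 𝓘(ℝ, E) 𝓘(ℝ, F) ∞ r y) ∧
      ∀ᶠ q' in 𝓝 q, r (ι q') = q' := by
  have : CompleteSpace F := FiniteDimensional.complete ℝ F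
  -- in charts, compose `ι` with a linear left inverse `pr` of its derivative `D`, and invert the
  -- resulting map of `F`
  let D : F →L[ℝ] E := mfderiv 𝓘(ℝ, F) 𝓘(ℝ, E) ι q
  obtain ⟨p, hp⟩ := D.toLinearMap.exists_leftInverse_of_injective (LinearMap.ker_eq_bot.2 hinj)
  let pr : E →L[ℝ] F := LinearMap.toContinuousLinearMap p
  have hpr : pr ∘L D = ContinuousLinearMap.id ℝ F :=
    ContinuousLinearMap.ext fun v ↦ LinearMap.congr_fun hp v
  set c := extChartAt 𝓘(ℝ, F) q
  set c' := extChartAt 𝓘(ℝ, E) (ι q)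
  have hqs : q ∈ c.source := mem_extChartAt_source q
  have hcq : c.symm (c q) = q := c.left_inv hqs
  have hcts : ContinuousAt c.symm (c q) := continuousAt_extChartAt_symm q
  have hcts' : Tendsto c.symm (𝓝 (c q)) (𝓝 q) := by rwa [ContinuousAt, hcq] at hcts
  have hιq : Tendsto ι (𝓝 q) (𝓝 (ι q)) := hι.continuous.continuousAt
  have hd : HasFDerivAt (c' ∘ ι ∘ c.symm) D (c q) := by
    have : HasFDerivWithinAt (c' ∘ ι ∘ c.symm) D (Set.range 𝓘(ℝ, F)) (c q) :=
      ((hι q).mdifferentiableAt (by simp)).hasMFDerivAt.2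
    rwa [ModelWithCorners.range_eq_univ, hasFDerivWithinAt_univ] at this
  have hsm : ∀ᶠ z in 𝓝 (c q), ContDiffAt ℝ ∞ (pr ∘ c' ∘ ι ∘ c.symm) z := by
    filter_upwards [extChartAt_target_mem_nhds (I := 𝓘(ℝ, F)) q,
      (hιq.comp hcts').eventually (extChartAt_source_mem_nhds (I := 𝓘(ℝ, E)) (ι q))] with z hz hz'
    have h1 : ContMDiffAt 𝓘(ℝ, F) 𝓘(ℝ, F) ∞ c.symm z :=
      (contMDiffOn_extChartAt_symm q).contMDiffAt ((isOpen_extChartAt_target q).mem_nhds hz)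
    have h2 : ContMDiffAt 𝓘(ℝ, E) 𝓘(ℝ, E) ∞ c' (ι (c.symm z)) :=
      contMDiffAt_extChartAt' ((extChartAt_source 𝓘(ℝ, E) (ι q)).subset hz')
    have h3 : ContMDiffAt 𝓘(ℝ, E) 𝓘(ℝ, F) ∞ pr (c' (ι (c.symm z))) := pr.contDiff.contMDiff _
    exact (h3.comp z (h2.comp z ((hι _).comp z h1))).contDiffAt
  have hder : HasFDerivAt (pr ∘ c' ∘ ι ∘ c.symm) (ContinuousLinearMap.id ℝ F) (c q) := by
    rw [← hpr]
    exact pr.hasFDerivAt.comp _ hd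
  obtain ⟨s, hs, hs'⟩ := exists_local_leftInverse hsm hder
  have hval : (pr ∘ c' ∘ ι ∘ c.symm) (c q) = pr (c' (ι q)) := by simp [hcq]
  rw [hval] at hs
  have hρ : Tendsto (fun y ↦ pr (c' y)) (𝓝 (ι q)) (𝓝 (pr (c' (ι q)))) :=
    (pr.continuous.continuousAt.comp (continuousAt_extChartAt (ι q)))
  have hcc : Tendsto c (𝓝 q) (𝓝 (c q)) := continuousAt_extChartAt q
  have hret : ∀ᶠ q' in 𝓝 q, s (pr (c' (ι q'))) = c q' := by
    filter_upwards [hcc.eventually hs', extChartAt_source_mem_nhds (I := 𝓘(ℝ, F)) q] with q' h1 h2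
    simpa [c.left_inv h2] using h1
  refine ⟨fun y ↦ c.symm (s (pr (c' y))), ?_, ?_⟩
  · have hs0 : s (pr (c' (ι q))) = c q := hret.self_of_nhds
    have hsc : Tendsto s (𝓝 (pr (c' (ι q)))) (𝓝 (c q)) := by
      have := hs.self_of_nhds.continuousAt
      rwa [ContinuousAt, hs0] at this
    filter_upwards [hρ.eventually hs, extChartAt_source_mem_nhds (I := 𝓘(ℝ, E)) (ι q),
      (hsc.comp hρ).eventually (extChartAt_target_mem_nhds (I := 𝓘(ℝ, F)) q)] with y h1 h2 h3
    have g1 : ContMDiffAt 𝓘(ℝ, E) 𝓘(ℝ, E) ∞ c' y :=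
      contMDiffAt_extChartAt' ((extChartAt_source 𝓘(ℝ, E) (ι q)).subset h2)
    have g2 : ContMDiffAt 𝓘(ℝ, E) 𝓘(ℝ, F) ∞ pr (c' y) := pr.contDiff.contMDiff _
    have g3 : ContMDiffAt 𝓘(ℝ, F) 𝓘(ℝ, F) ∞ c.symm (s (pr (c' y))) :=
      (contMDiffOn_extChartAt_symm q).contMDiffAt ((isOpen_extChartAt_target q).mem_nhds h3)
    exact g3.comp y (h1.contMDiffAt.comp y (g2.comp y g1))
  · filter_upwards [hret, extChartAt_source_mem_nhds (I := 𝓘(ℝ, F)) q] with q' h1 h2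
    rw [h1, c.left_inv h2]

omit [T2Space N] in
/-- Along an immersion, vector fields extend locally to the ambient manifold. -/
theorem exists_relatedAt (hι : ContMDiff 𝓘(ℝ, F) 𝓘(ℝ, E) ∞ ι)
    (hinj : Function.Injective (mfderiv 𝓘(ℝ, F) 𝓘(ℝ, E) ι q)) (hX : IsSmooth X) :
    ∃ X' : Field E M, IsSmooth X' ∧ RelatedAt ι q X X' := by
  obtain ⟨r, hr, hrι⟩ := exists_local_retraction hι hinj
  set t := trivializationAt E (TangentSpace 𝓘(ℝ, E)) (ι q) with ht
  have hqt : ι q ∈ t.baseSet := FiberBundle.mem_baseSet_trivializationAt' (ι q)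
  have hιq : Tendsto ι (𝓝 q) (𝓝 (ι q)) := hι.continuous.continuousAt
  let V : N → TotalSpace E (TangentSpace 𝓘(ℝ, E) : M → Type _) := fun q' ↦
    ⟨ι q', mfderiv 𝓘(ℝ, F) 𝓘(ℝ, E) ι q' (X q')⟩
  have hV : ContMDiff 𝓘(ℝ, F) (𝓘(ℝ, E).prod 𝓘(ℝ, E)) ∞ V :=
    (hι.contMDiff_tangentMap (m := ∞) (by simp)).comp hX
  have hc : ∀ᶠ q' in 𝓝 q, ContMDiffAt 𝓘(ℝ, F) 𝓘(ℝ, E) ∞ (fun z ↦ (t (V z)).2) q' := by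
    filter_upwards [hιq.eventually (t.open_baseSet.mem_nhds hqt)] with q' hq'
    exact ((t.contMDiffAt_iff (x₀ := q') hq').1 (hV q')).2
  have hrq : r (ι q) = q := hrι.self_of_nhds
  have hrt : Tendsto r (𝓝 (ι q)) (𝓝 q) := by
    have := hr.self_of_nhds.continuousAt
    rwa [ContinuousAt, hrq] at this
  -- the components of `dι X` in a trivialization are extended by composition with the retraction
  obtain ⟨X', hX', hXX'⟩ := exists_isSmooth_eventuallyEq (x := ι q)
    (X := fun y ↦ t.symm y (t (V (r y))).2) <| by
      filter_upwards [t.open_baseSet.mem_nhds hqt, hr, hrt.eventually hc] with y hy h1 h2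
      rw [t.contMDiffAt_section_iff hy]
      refine (h2.comp y h1).congr_of_eventuallyEq ?_
      filter_upwards [t.open_baseSet.mem_nhds hy] with z hz
      simp [hz]
  refine ⟨X', hX', ?_⟩
  filter_upwards [hιq.eventually hXX', hιq.eventually (t.open_baseSet.mem_nhds hqt), hrι]
    with q' h1 h2 h3
  rw [h1, h3]
  exact (t.symm_proj_apply (V q') h2).symm

end Related

section Pullback

open Filter Topology

variable {F : Type*} [NormedAddCommGroup F] [NormedSpace ℝ F] [FiniteDimensional ℝ F]
  {N : Type*} [TopologicalSpace N] [ChartedSpace F N] [IsManifold 𝓘(ℝ, F) ∞ N] [T2Space N]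

/-! ### The induced metric -/

/-- A field of bilinear forms is smooth if its values on smooth vector fields are smooth. -/
theorem contMDiff_bilin_of_apply
    {B : Π q : N, TangentSpace 𝓘(ℝ, F) q →L[ℝ] TangentSpace 𝓘(ℝ, F) q →L[ℝ] ℝ}
    (h : ∀ X Y : Field F N, IsSmooth X → IsSmooth Y →
      ContMDiff 𝓘(ℝ, F) 𝓘(ℝ, ℝ) ∞ (fun q ↦ B q (X q) (Y q))) :
    ContMDiff 𝓘(ℝ, F) (𝓘(ℝ, F).prod 𝓘(ℝ, F →L[ℝ] F →L[ℝ] ℝ)) ∞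
      (fun q ↦ TotalSpace.mk' (F →L[ℝ] F →L[ℝ] ℝ)
        (E := fun q : N ↦ TangentSpace 𝓘(ℝ, F) q →L[ℝ] TangentSpace 𝓘(ℝ, F) q →L[ℝ] ℝ)
        q (B q)) := by
  intro q
  rw [contMDiffAt_hom_bundle]
  refine ⟨contMDiffAt_id, contMDiffAt_clm_of_apply fun v ↦ contMDiffAt_clm_of_apply fun w ↦ ?_⟩
  set t := trivializationAt F (TangentSpace 𝓘(ℝ, F)) q with ht
  have hqt : q ∈ t.baseSet := FiberBundle.mem_baseSet_trivializationAt' q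
  have hex : ∀ v : F, ∃ X : Field F N, IsSmooth X ∧ X =ᶠ[𝓝 q] fun y ↦ t.symm y v := fun v ↦ by
    refine exists_isSmooth_eventuallyEq ?_
    filter_upwards [t.open_baseSet.mem_nhds hqt] with y hy
    rw [t.contMDiffAt_section_iff hy]
    refine contMDiffAt_const.congr_of_eventuallyEq (f := fun _ ↦ v) ?_
    filter_upwards [t.open_baseSet.mem_nhds hy] with z hz
    simp [hz]
  obtain ⟨X, hX, hXv⟩ := hex v
  obtain ⟨Y, hY, hYw⟩ := hex w
  refine (h X Y hX hY q).congr_of_eventuallyEq ?_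
  filter_upwards [hXv, hYw, t.open_baseSet.mem_nhds hqt] with y h1 h2 hy
  rw [inCoordinates_apply_eq₂ hy hy (Set.mem_univ _), h1, h2]
  simp [← ht]

variable {E : Type*} [NormedAddCommGroup E] [NormedSpace ℝ E] [FiniteDimensional ℝ E]
  {M : Type*} [TopologicalSpace M] [ChartedSpace E M] [IsManifold 𝓘(ℝ, E) ∞ M] [T2Space M]

/-- The Riemannian metric induced on an immersed submanifold. -/
theorem exists_metric_pullback (g : Metric E M) {ι : N → M} (hι : ContMDiff 𝓘(ℝ, F) 𝓘(ℝ, E) ∞ ι)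
    (hinj : ∀ q, Function.Injective (mfderiv 𝓘(ℝ, F) 𝓘(ℝ, E) ι q)) :
    ∃ gN : Metric F N, ∀ (q : N) (v w : TangentSpace 𝓘(ℝ, F) q), gN.inner q v w =
      g.inner (ι q) (mfderiv 𝓘(ℝ, F) 𝓘(ℝ, E) ι q v) (mfderiv 𝓘(ℝ, F) 𝓘(ℝ, E) ι q w) := by
  let B : Π q : N, TangentSpace 𝓘(ℝ, F) q →L[ℝ] TangentSpace 𝓘(ℝ, F) q →L[ℝ] ℝ := fun q ↦
    (mfderiv 𝓘(ℝ, F) 𝓘(ℝ, E) ι q).precomp ℝ ∘L g.inner (ι q) ∘L mfderiv 𝓘(ℝ, F) 𝓘(ℝ, E) ι q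
  have hB : ∀ (q : N) (v w : TangentSpace 𝓘(ℝ, F) q), B q v w =
      g.inner (ι q) (mfderiv 𝓘(ℝ, F) 𝓘(ℝ, E) ι q v) (mfderiv 𝓘(ℝ, F) 𝓘(ℝ, E) ι q w) :=
    fun q v w ↦ rfl
  refine ⟨⟨B, fun q v w ↦ ?_, fun q v hv ↦ ?_, fun q ↦ ?_, ?_⟩, hB⟩
  · rw [hB, hB, g.symm]
  · rw [hB]
    exact g.pos _ _ ((map_ne_zero_iff _ (hinj q)).2 hv)
  · -- the unit ball of the induced metric lies in the image of that of `g` under a left inverse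
    -- of `dι`
    have : FiniteDimensional ℝ (TangentSpace 𝓘(ℝ, E) (ι q)) :=
      inferInstanceAs (FiniteDimensional ℝ E)
    have : T2Space (TangentSpace 𝓘(ℝ, E) (ι q)) := inferInstanceAs (T2Space E)
    obtain ⟨p, hp⟩ := (mfderiv 𝓘(ℝ, F) 𝓘(ℝ, E) ι q).toLinearMap.exists_leftInverse_of_injective
      (LinearMap.ker_eq_bot.2 (hinj q))
    refine ((g.isVonNBounded (ι q)).image (LinearMap.toContinuousLinearMap p)).subset ?_
    intro v hv
    refine ⟨mfderiv 𝓘(ℝ, F) 𝓘(ℝ, E) ι q v, ?_, LinearMap.congr_fun hp v⟩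
    rwa [Set.mem_ofPred_eq, hB] at hv
  · refine contMDiff_bilin_of_apply fun X Y hX hY q ↦ ?_
    obtain ⟨X', hX', hXX'⟩ := exists_relatedAt hι (hinj q) hX
    obtain ⟨Y', hY', hYY'⟩ := exists_relatedAt hι (hinj q) hY
    refine (((IsSmooth.inner g hX' hY').comp hι) q).congr_of_eventuallyEq ?_
    filter_upwards [hXX', hYY'] with y h1 h2
    rw [hB, h1, h2]
    rfl

end Pullback

namespace AlmostContactMetric

section Kaehler

open Filter Topology

variable {E : Type*} [NormedAddCommGroup E] [NormedSpace ℝ E] [FiniteDimensional ℝ E]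
  {M : Type*} [TopologicalSpace M] [ChartedSpace E M] [IsManifold 𝓘(ℝ, E) ∞ M] [T2Space M]
  {S : AlmostContactMetric E M} {α : ℝ}

/-! ### The leaves of `ker η` -/

/-- The Nijenhuis tensor of `φ` vanishes on `ker η` if `∇φ` takes values in the span of `ξ`
there. -/
theorem nijenhuis_φ (hS : S.IsAlmostCosymplectic α)
    (hφ : ∀ X Y : Field E M, IsSmooth X → IsSmooth Y → ∀ x : M,
      covDerivEnd S.g S.φ.act X Y x = -(S.g.inner x (S.φ x (S.A α X x)) (Y x)) • S.ξ x
        + S.η x (Y x) • S.φ x (S.A α X x))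
    {X Y : Field E M} (hX : IsSmooth X) (hY : IsSmooth Y) {x : M} (hηX : S.η x (X x) = 0)
    (hηY : S.η x (Y x) = 0) :
    S.φ x (S.φ x (bracket X Y x)) + bracket (S.φ.act X) (S.φ.act Y) x
      - S.φ x (bracket (S.φ.act X) Y x) - S.φ x (bracket X (S.φ.act Y) x) = 0 := by
  have hφX := S.smooth_act hX
  have hφY := S.smooth_act hY
  have hcov : ∀ {U V : Field E M}, IsSmooth U → IsSmooth V → S.η x (V x) = 0 →
      leviCivita S.g U (S.φ.act V) x = S.φ x (leviCivita S.g U V x)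
        + S.g.inner x (S.φ x (S.nablaXi x (U x))) (V x) • S.ξ x := fun {U V} hU hV hηV ↦ by
    have h := hφ U V hU hV x
    rw [A_eq hS hU, hηV, covDerivEnd, Pi.sub_apply, sub_eq_iff_eq_add] at h
    rw [h]
    simp only [Pi.neg_apply, EndField.act, map_neg, _root_.neg_apply]
    module
  -- `(X, Y) ↦ g(φ ∇_{φ X} ξ, Y)` is symmetric
  have hsymm : S.g.inner x (S.φ x (S.nablaXi x (S.φ.act X x))) (Y x) =
      S.g.inner x (S.φ x (S.nablaXi x (S.φ.act Y x))) (X x) := by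
    rw [EndField.act, EndField.act, inner_φ, nablaXi_symm hS, S.g.symm x (S.φ x (X x)), ← inner_φ]
  rw [bracket_eq S.g hX hY, bracket_eq S.g hφX hφY, bracket_eq S.g hφX hY, bracket_eq S.g hX hφY]
  simp only [Pi.sub_apply, hcov hφX hY hηY, hcov hφY hX hηX, hcov hX hY hηY, hcov hY hX hηX,
    map_sub, map_add, map_smul, φ_ξ, hsymm]
  module

omit [FiniteDimensional ℝ E] [T2Space M] in
theorem extDerivTwo_fundForm_eq_zero (hS : S.IsAlmostCosymplectic α) {X Y Z : Field E M}
    (hX : IsSmooth X) (hY : IsSmooth Y) (hZ : IsSmooth Z) {x : M} (hηX : S.η x (X x) = 0)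
    (hηY : S.η x (Y x) = 0) (hηZ : S.η x (Z x) = 0) :
    extDerivTwo (fundForm S.φ S.g) X Y Z x = 0 := by
  rw [hS.d_fundForm X Y Z hX hY hZ, wedgeOneTwo, hηX, hηY, hηZ]
  ring

variable {F : Type*} [NormedAddCommGroup F] [NormedSpace ℝ F] [FiniteDimensional ℝ F]
  {N : Type*} [TopologicalSpace N] [ChartedSpace F N] [IsManifold 𝓘(ℝ, F) ∞ N] [T2Space N]

theorem inducesKaehlerOn (hS : S.IsAlmostCosymplectic α)
    (hφ : ∀ X Y : Field E M, IsSmooth X → IsSmooth Y → ∀ x : M,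
      covDerivEnd S.g S.φ.act X Y x = -(S.g.inner x (S.φ x (S.A α X x)) (Y x)) • S.ξ x
        + S.η x (Y x) • S.φ x (S.A α X x))
    {ι : N → M} (hι : S.IsIntegralSubmanifold (F := F) ι) :
    S.InducesKaehlerOn (F := F) ι := by
  have hCE : CompleteSpace E := FiniteDimensional.complete ℝ E
  have hCF : CompleteSpace F := FiniteDimensional.complete ℝ F
  set L : Π q : N, TangentSpace 𝓘(ℝ, F) q →L[ℝ] TangentSpace 𝓘(ℝ, E) (ι q) :=
    fun q ↦ mfderiv 𝓘(ℝ, F) 𝓘(ℝ, E) ι q with hL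
  have hηL : ∀ q v, S.η (ι q) (L q v) = 0 := fun q v ↦
    (hι.range_eq q).subset (Set.mem_range_self v)
  have hinj : ∀ q, Function.Injective (L q) := hι.injective
  -- the almost complex structure is `dι⁻¹ ∘ φ ∘ dι`
  have hJ : ∀ q, ∃ j : TangentSpace 𝓘(ℝ, F) q →L[ℝ] TangentSpace 𝓘(ℝ, F) q,
      ∀ v, L q (j v) = S.φ (ι q) (L q v) := fun q ↦ by
    obtain ⟨p, hp⟩ := (L q).toLinearMap.exists_leftInverse_of_injective
      (LinearMap.ker_eq_bot.2 (hinj q))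
    have : FiniteDimensional ℝ (TangentSpace 𝓘(ℝ, F) q) := inferInstanceAs (FiniteDimensional ℝ F)
    have : T2Space (TangentSpace 𝓘(ℝ, F) q) := inferInstanceAs (T2Space F)
    refine ⟨LinearMap.toContinuousLinearMap (p ∘ₗ (S.φ (ι q)).toLinearMap ∘ₗ
      (L q).toLinearMap), fun v ↦ ?_⟩
    obtain ⟨w, hw⟩ := (hι.range_eq q).superset (S.η_φ (ι q) (L q v))
    change L q (p (S.φ (ι q) (L q v))) = _
    rw [← hw]
    exact congrArg (L q) (LinearMap.congr_fun hp w)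
  choose J hJ using hJ
  obtain ⟨gN, hgN⟩ := exists_metric_pullback S.g hι.smooth hι.injective
  have hJrel : ∀ {q : N} {X : Field F N} {X' : Field E M}, RelatedAt ι q X X' →
      RelatedAt ι q (EndField.act J X) (S.φ.act X') := fun {q X X'} h ↦ by
    filter_upwards [h] with y hy
    rw [EndField.act, EndField.act, ← hy]
    exact hJ y _
  have hform : ∀ {q : N} {X Y : Field F N} {X' Y' : Field E M},
      L q (X q) = X' (ι q) → L q (Y q) = Y' (ι q) →
      fundForm J gN X Y q = fundForm S.φ S.g X' Y' (ι q) := fun {q X Y X' Y'} h h' ↦ by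
    rw [fundForm, fundForm, hgN, ← h, ← h', ← hJ]
  have hext : ∀ (q : N) {X : Field F N}, IsSmooth X → ∃ X' : Field E M, IsSmooth X' ∧
      RelatedAt ι q X X' := fun q X hX ↦ exists_relatedAt hι.smooth (hinj q) hX
  have hηrel : ∀ {q : N} {X : Field F N} {X' : Field E M}, RelatedAt ι q X X' →
      S.η (ι q) (X' (ι q)) = 0 := fun {q X X'} h ↦ by
    rw [← h.apply_eq]
    exact hηL q _
  have hJsm : ∀ X, IsSmooth X → IsSmooth (EndField.act J X) := fun X hX ↦ by
    refine isSmooth_of_inner gN fun Z hZ q ↦ ?_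
    obtain ⟨X', hX', hXX'⟩ := hext q hX
    obtain ⟨Z', hZ', hZZ'⟩ := hext q hZ
    refine (((IsSmooth.inner S.g (S.smooth_act hX') hZ').comp hι.smooth) q).congr_of_eventuallyEq ?_
    filter_upwards [hXX', hZZ'] with y h1 h2 using hform h1 h2
  refine ⟨J, gN, hJ, hgN, isSmoothEnd_of_act hJsm, fun q v ↦ hinj q ?_, fun q v w ↦ ?_,
    fun X Y hX hY ↦ funext fun q ↦ hinj q ?_, fun X Y Z hX hY hZ ↦ funext fun q ↦ ?_⟩
  · rw [hJ, hJ, φ_sq, hηL, zero_smul, add_zero, map_neg]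
  · rw [hgN, hgN]
    change S.g.inner (ι q) (L q (J q v)) (L q (J q w)) = _
    rw [hJ, hJ, S.compatible, hηL, zero_mul, sub_zero]
  · obtain ⟨X', hX', hXX'⟩ := hext q hX
    obtain ⟨Y', hY', hYY'⟩ := hext q hY
    have hbr : ∀ {U V : Field F N} {U' V' : Field E M}, IsSmooth U → IsSmooth V → IsSmooth U' →
        IsSmooth V' → RelatedAt ι q U U' → RelatedAt ι q V V' →
        L q (bracket U V q) = bracket U' V' (ι q) := fun hU hV hU' hV' h h' ↦
      h.bracket_apply hι.smooth hU hV hU' hV' h'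
    simp only [Pi.add_apply, Pi.sub_apply, Pi.zero_apply, map_add, map_sub, map_zero]
    rw [EndField.act, EndField.act, EndField.act, EndField.act, hJ, hJ, hJ, hJ,
      hbr hX hY hX' hY' hXX' hYY',
      hbr (hJsm X hX) (hJsm Y hY) (S.smooth_act hX') (S.smooth_act hY') (hJrel hXX') (hJrel hYY'),
      hbr (hJsm X hX) hY (S.smooth_act hX') hY' (hJrel hXX') hYY',
      hbr hX (hJsm Y hY) hX' (S.smooth_act hY') hXX' (hJrel hYY')]
    exact nijenhuis_φ hS hφ hX' hY' (hηrel hXX') (hηrel hYY')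
  · obtain ⟨X', hX', hXX'⟩ := hext q hX
    obtain ⟨Y', hY', hYY'⟩ := hext q hY
    obtain ⟨Z', hZ', hZZ'⟩ := hext q hZ
    have hd : ∀ {U V W : Field F N} {U' V' W' : Field E M}, IsSmooth V' → IsSmooth W' →
        RelatedAt ι q U U' → RelatedAt ι q V V' → RelatedAt ι q W W' →
        dirDeriv U (fundForm J gN V W) q = dirDeriv U' (fundForm S.φ S.g V' W') (ι q) :=
      fun {U V W U' V' W'} hV' hW' h h' h'' ↦ by
        refine Eq.trans (dirDeriv_congr ?_) <| dirDeriv_comp hι.smooth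
          (IsSmooth.inner S.g (S.smooth_act hV') hW') h.apply_eq
        filter_upwards [h', h''] with y h1 h2 using hform h1 h2
    have hb : ∀ {U V W : Field F N} {U' V' W' : Field E M}, IsSmooth U → IsSmooth V →
        IsSmooth U' → IsSmooth V' → RelatedAt ι q U U' → RelatedAt ι q V V' →
        RelatedAt ι q W W' →
        fundForm J gN (bracket U V) W q = fundForm S.φ S.g (bracket U' V') W' (ι q) :=
      fun hU hV hU' hV' h h' h'' ↦
        hform (h.bracket_apply hι.smooth hU hV hU' hV' h') h''.apply_eq
    rw [extDerivTwo, hd hY' hZ' hXX' hYY' hZZ', hd hZ' hX' hYY' hZZ' hXX',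
      hd hX' hY' hZZ' hXX' hYY', hb hX hY hX' hY' hXX' hYY' hZZ',
      hb hY hZ hY' hZ' hYY' hZZ' hXX', hb hZ hX hZ' hX' hZZ' hXX' hYY']
    exact extDerivTwo_fundForm_eq_zero hS hX' hY' hZ' (hηrel hXX') (hηrel hYY') (hηrel hZZ')

end Kaehler

end AlmostContactMetric

end AlmostContact

theorem mainTheorem4 (n : ℕ) {M : Type*} [TopologicalSpace M] [T2Space M] [ConnectedSpace M]
    [ChartedSpace (EuclideanSpace ℝ (Fin (2 * n + 1))) M] [IsManifold (𝓡 (2 * n + 1)) ∞ M]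
    (α : ℝ) (S : AlmostContact.AlmostContactMetric (EuclideanSpace ℝ (Fin (2 * n + 1))) M)
    (hS : S.IsAlmostCosymplectic α)
    (h_xi : ∀ Y : AlmostContact.Field (EuclideanSpace ℝ (Fin (2 * n + 1))) M,
      AlmostContact.IsSmooth Y → AlmostContact.covDerivEnd S.g S.h S.ξ Y = 0)
    (h_curv : ∃ p : M, S.XiSectionalCurvatureNeAt (-α ^ 2) p)
    (h_par : S.IsEtaParallel S.h) :
    (∀ X Y : AlmostContact.Field (EuclideanSpace ℝ (Fin (2 * n + 1))) M,
      AlmostContact.IsSmooth X → AlmostContact.IsSmooth Y → ∀ x : M,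
        AlmostContact.covDerivEnd S.g S.φ.act X Y x =
          -(S.g.inner x (S.φ x (S.A α X x)) (Y x)) • S.ξ x
            + S.η x (Y x) • S.φ x (S.A α X x)) ∧
    (∀ {N : Type*} [TopologicalSpace N] [T2Space N]
      [ChartedSpace (EuclideanSpace ℝ (Fin (2 * n))) N] [IsManifold (𝓡 (2 * n)) ∞ N]
      (ι : N → M), S.IsIntegralSubmanifold (F := EuclideanSpace ℝ (Fin (2 * n))) ι →
        S.InducesKaehlerOn (F := EuclideanSpace ℝ (Fin (2 * n))) ι) := by
  have hp := S.isEtaParallel_φ hS h_par (S.hEnd_injective hS h_par h_xi h_curv)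
  have hφ := fun X Y (hX : AlmostContact.IsSmooth X) (hY : AlmostContact.IsSmooth Y) x ↦
    S.covDerivEnd_φ_eq hS hp hX hY x
  exact ⟨hφ, fun ι hι ↦ S.inducesKaehlerOn hS hφ hι⟩
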